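/- **Setting.** Let $M$ be an $n$-dimensional complex manifold (Hausdorff, second countable), $A^2(M)$ the Hilbert space of holomorphic $n$-forms $f$ with $|\int_M f\wedge\bar f|<\infty$, $\{\phi_j\}$ a complete orthonormal basis of $A^2(M)$, and $K(z,\bar w)=\sum_j\phi_j(z)\wedge\overline{\phi_j(w)}$ the Bergman kernel form. In local coordinates $(U,z)$, $(V,w)$ write $K=K^*_{U\times\bar V}(z,\bar w)\,dz_1\wedge\cdots\wedge dz_n\wedge d\bar w_1\wedge\cdots\wedge d\bar w_n$ and $G(z,\bar w)=(g_{j\bar k}(z,\bar w))$, $g_{j\bar k}=\partial^2\log K^*/\partial z_j\partial\bar w_k$; write $g^{\bar kj}$ for the $(k,j)$ entry of $G^{-1}$. Suppose that $M$ has the Bergman metric: $K(z,\bar z)\neq0$ and $G(z,\bar z)$ is positive definite for all $z\in M$. For $p\in M$ let $M^p$ be the set of $z\in M$ with $K(z,\bar p)\ne0$ and $\det G(z,\bar p)\neq0$. The Bochner connection $\nabla^p$ on $M^p$ is the holomorphic affine connection with Christoffel symbols $\Gamma^j_{kl}(z)=\sum_m\frac{\partial g_{k\bar m}(z,\bar p)}{\partial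 z_l}\,g^{\bar mj}(z,\bar p)$. For $q\in M^p$ the affine exponential map $\mathrm{exph}_q$ sends $\zeta\in T'_qM^p$ to $\gamma(1)$, where $\gamma$ is the geodesic of $\nabla^p$ (with real time, in $M^p$) with $\gamma(0)=q$, $\gamma'(0)=\zeta$; its domain $D_q$ is the set of all $\zeta$ for which $\gamma$ exists on an open interval containing $[0,1]$. Put $I_q=\mathrm{exph}_q(D_q)$. **Proposition.** The set $M^p$ is open and contains $p$. For every $q\in M^p$ the map $\mathrm{exph}_q$ is well defined, $D_q$ is an open set containing $0$, $\mathrm{exph}_q(0)=q$, and $\mathrm{exph}_q$ is a biholomorphism of $D_q$ onto the open set $I_q\subseteq M^p$. Moreover: 1. Let $(U,z)$ and $(V,w)$ be local coordinates at $q$ and at $p$, let $G(q,\bar p)=AB$ be any factorization into $n\times n$ matrices, and let $(\zeta_1,\dots,\zeta_n)$ be the linear coordinates $\zeta=(dz_1,\dots,dz_n)A$ on $T'_qM^p$. Then for all $z\in U\cap I_q$, $\mathrm{exph}_q^{-1}(z)$ has the coordinates $$\zeta_j(z)=\sum_k (B^{-1})_{kj}\Big\{\frac{\partial}{\partial\bar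 w_k}\Big|_{w=p}\log K^*_{U\times\bar V}(z,\bar w)-\frac{\partial}{\partial\bar w_k}\Big|_{w=p}\log K^*_{U\times\bar V}(q,\bar w)\Big\},\qquad j=1,\dots,n.$$ (For $A=I$ the normalization is $g^{\bar kj}(q,\bar p)$; for $A=B$ it is the inverse of a square root of $G(q,\bar p)$.) 2. Fix coordinates $w$ at $p$ and let $\mathrm{rep}_p$ be the map on $M^p$ with components $\sum_k g^{\bar kj}(p,\bar p)\{\frac{\partial}{\partial\bar w_k}|_{w=p}\log K^*(z,\bar w)-\frac{\partial}{\partial\bar w_k}|_{w=p}\log K^*(p,\bar w)\}$, $j=1,\dots,n$. Then $\mathrm{exph}_p^{-1}=\mathrm{rep}_p$ on $I_p$ in the coordinates $dw$ on $T'_pM$, and for every $q\in M^p$ there is a linear isomorphism $L:\mathbb C^n\to T'_qM^p$ with $\mathrm{exph}_q^{-1}(z)=L(\mathrm{rep}_p(z)-\mathrm{rep}_p(q))$ for all $z\in I_q$. For all $q,r\in M^p$ there are a linear isomorphism $L:T'_qM^p\to T'_rM^p$ and $c\in T'_rM^p$ with $\mathrm{exph}_r^{-1}=L\circ\mathrm{exph}_q^{-1}+c$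 on $I_q\cap I_r$. 3. $M^p$ carries a complex affine structure, that is, a maximal set of holomorphic charts covering $M^p$ all of whose transition maps are restrictions of complex affine transformations of $\mathbb C^n$, which for every $q\in M^p$ contains the chart $\mathrm{exph}_q^{-1}$ on $I_q$ (in suitable linear coordinates on $T'_qM^p$), and such that the Christoffel symbols of $\nabla^p$ vanish in every chart of it. -/

import Mathlib

open scoped Manifold ContDiff Topology ComplexConjugate ComplexOrder

noncomputable section

namespace BergmanGeometry

/-- Complex `n`-space, the model of `n`-dimensional complex manifolds. -/
abbrev CSpace (n : ℕ) : Type := Fin n → ℂ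

/-! ### Local coordinates and `(n,0)`-forms -/

section Forms

variable {n : ℕ} (M : Type*) [TopologicalSpace M] [ChartedSpace (CSpace n) M]

/-- The local holomorphic coordinate systems `(U, (z_1, …, z_n))` of `M`. -/
def holCharts : Set (OpenPartialHomeomorph M (CSpace n)) :=
  IsManifold.maximalAtlas 𝓘(ℂ, CSpace n) ω M

/-- Rough `(n,0)`-forms on `M`: a complex alternating `n`-linear form on each holomorphic tangent
space. -/
abbrev TopForm : Type _ :=
  (x : M) → (TangentSpace 𝓘(ℂ, CSpace n) x) [⋀^Fin n]→L[ℂ] ℂ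

variable {M}

/-- The coordinate frame `∂/∂z_1, …, ∂/∂z_n` of the coordinate system `e`, at the point with
coordinates `z`. -/
def chartFrame (e : OpenPartialHomeomorph M (CSpace n)) (z : CSpace n) (i : Fin n) :
    TangentSpace 𝓘(ℂ, CSpace n) (e.symm z) :=
  mfderiv 𝓘(ℂ, CSpace n) 𝓘(ℂ, CSpace n) e.symm z (Pi.single i 1 : Fin n → ℂ)

/-- The components `(dz_1(v), …, dz_n(v))` in the coordinate system `e` of tangent vectors `v`
at `x`. -/
def chartCoord (e : OpenPartialHomeomorph M (CSpace n)) (x : M) :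
    TangentSpace 𝓘(ℂ, CSpace n) x →L[ℂ] CSpace n :=
  mfderiv 𝓘(ℂ, CSpace n) 𝓘(ℂ, CSpace n) e x

/-- The coefficient `f_e` in `f = f_e(z) dz_1 ∧ ⋯ ∧ dz_n`. -/
def formCoeff (f : TopForm (n := n) M) (e : OpenPartialHomeomorph M (CSpace n))
    (z : CSpace n) : ℂ :=
  f (e.symm z) (chartFrame e z)

/-- Holomorphic `n`-forms. -/
def IsHolomorphicForm (f : TopForm (n := n) M) : Prop :=
  ∀ e ∈ holCharts (n := n) M, DifferentiableOn ℂ (formCoeff f e) e.target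

end Forms

/-! ### Integration of `f ∧ conj g` and the Hilbert space `A²(M)` -/

section Bergman

variable {n : ℕ} {M : Type*} [TopologicalSpace M] [ChartedSpace (CSpace n) M]

lemma exists_chart_cover (n : ℕ) (M : Type*) [TopologicalSpace M] [ChartedSpace (CSpace n) M]
    [SecondCountableTopology M] [Nonempty M] :
    ∃ c : ℕ → M, ⋃ k, (chartAt (CSpace n) (c k)).source = Set.univ := by
  obtain ⟨s, hs, hc⟩ := TopologicalSpace.countable_cover_nhds
    (fun x : M => chart_source_mem_nhds (CSpace n) x)
  have hne : s.Nonempty := by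
    by_contra h
    rw [Set.not_nonempty_iff_eq_empty] at h
    subst h
    exact Set.empty_ne_univ (by simpa using hc)
  obtain ⟨c, rfl⟩ := hs.exists_eq_range hne
  exact ⟨c, by simpa using hc⟩

/-- The centres of a countable family of charts that cover `M`. -/
def coverCenter (n : ℕ) (M : Type*) [TopologicalSpace M] [ChartedSpace (CSpace n) M]
    [SecondCountableTopology M] [Nonempty M] : ℕ → M :=
  (exists_chart_cover n M).choose

/-- The `k`-th chart of the countable cover. -/
def coverChart (n : ℕ) (M : Type*) [TopologicalSpace M] [ChartedSpace (CSpace n) M]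
    [SecondCountableTopology M] [Nonempty M] (k : ℕ) : OpenPartialHomeomorph M (CSpace n) :=
  chartAt (CSpace n) (coverCenter n M k)

/-- The manifold is cut into the countably many disjoint Borel pieces
`source k \ ⋃ j < k, source j`; this is the `k`-th piece, read in the `k`-th chart. -/
def coverPiece (n : ℕ) (M : Type*) [TopologicalSpace M] [ChartedSpace (CSpace n) M]
    [SecondCountableTopology M] [Nonempty M] (k : ℕ) : Set (CSpace n) :=
  (coverChart n M k).target ∩
    (coverChart n M k).symm ⁻¹' disjointed (fun j => (coverChart n M j).source) k

variable [SecondCountableTopology M] [Nonempty M]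

/-- The hermitian product `i^{n²} ∫_M f ∧ conj g`. In coordinates
`i^{n²} dz_1 ∧ ⋯ ∧ dz_n ∧ conj dz_1 ∧ ⋯ ∧ conj dz_n` is `2^n` times Lebesgue measure. -/
def formInner (f g : TopForm (n := n) M) : ℂ :=
  2 ^ n * ∑' k, ∫ z in coverPiece n M k,
    formCoeff f (coverChart n M k) z * conj (formCoeff g (coverChart n M k) z)

/-- The space `A²(M)` of holomorphic `n`-forms with `|∫_M f ∧ conj f| < ∞`. -/
def bergmanSpace (n : ℕ) (M : Type*) [TopologicalSpace M] [ChartedSpace (CSpace n) M]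
    [SecondCountableTopology M] [Nonempty M] : Set (TopForm (n := n) M) :=
  {f | IsHolomorphicForm f ∧
    ∑' k, ∫⁻ z in coverPiece n M k, ‖formCoeff f (coverChart n M k) z‖ₑ ^ 2 < ⊤}

/-- `φ` is a complete orthonormal basis of the Hilbert space `A²(M)`. -/
structure IsBergmanBasis {ι : Type*} (φ : ι → TopForm (n := n) M) : Prop where
  mem : ∀ j, φ j ∈ bergmanSpace n M
  norm_one : ∀ j, formInner (φ j) (φ j) = 1
  orthogonal : ∀ j k, j ≠ k → formInner (φ j) (φ k) = 0
  complete : ∀ f ∈ bergmanSpace n M, (∀ j, formInner f (φ j) = 0) → f = 0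

end Bergman

/-! ### The Bergman kernel form and the Bergman metric -/

section Kernel

variable {n : ℕ} {M : Type*} [TopologicalSpace M] [ChartedSpace (CSpace n) M]
  {ι : Type*} (φ : ι → TopForm (n := n) M)

/-- The Bergman kernel form `K(x, ȳ) = ∑_j φ_j(x) ∧ conj φ_j(y)`, evaluated on `n` tangent vectors
at `x` and `n` tangent vectors at `y`. -/
def bergmanKernel (x y : M) (v : Fin n → TangentSpace 𝓘(ℂ, CSpace n) x)
    (u : Fin n → TangentSpace 𝓘(ℂ, CSpace n) y) : ℂ :=
  ∑' j, φ j x v * conj (φ j y u)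

/-- The function `K*(z, w̄)` in
`K(z, w̄) = K*(z, w̄) dz_1 ∧ ⋯ ∧ dz_n ∧ conj dw_1 ∧ ⋯ ∧ conj dw_n`, where `z` are the coordinates
of `e` and `w` those of `e'`. -/
def kernelFun (e e' : OpenPartialHomeomorph M (CSpace n)) (z w : CSpace n) : ℂ :=
  bergmanKernel φ (e.symm z) (e'.symm w) (chartFrame e z) (chartFrame e' w)

/-- The partial derivative `∂F/∂z_j` of a holomorphic function. -/
def dz (j : Fin n) (F : CSpace n → ℂ) (z : CSpace n) : ℂ :=
  lineDeriv ℂ F z (Pi.single j 1)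

/-- The Wirtinger derivative `∂F/∂w̄_k = (∂F/∂u_k + i ∂F/∂v_k)/2`, `w_k = u_k + i v_k`. -/
def dbar (k : Fin n) (F : CSpace n → ℂ) (w : CSpace n) : ℂ :=
  (lineDeriv ℝ F w (Pi.single k 1) + Complex.I * lineDeriv ℝ F w (Pi.single k Complex.I)) / 2

/-- `∂/∂w̄_k log K*(z, w̄)`, i.e. `(∂K*/∂w̄_k) / K*`, which does not involve a branch of `log`. -/
def dbarLogKernel (e e' : OpenPartialHomeomorph M (CSpace n)) (k : Fin n) (z w : CSpace n) : ℂ :=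
  dbar k (fun w' => kernelFun φ e e' z w') w / kernelFun φ e e' z w

/-- The matrix `G(z, w̄)` with entries `g_{jk̄}(z, w̄) = ∂² log K*(z, w̄) / ∂z_j ∂w̄_k`. -/
def metricMatrix (e e' : OpenPartialHomeomorph M (CSpace n)) (z w : CSpace n) :
    Matrix (Fin n) (Fin n) ℂ :=
  Matrix.of fun j k => dz j (fun z' => dbarLogKernel φ e e' k z' w) z

/-- `M` possesses the Bergman metric: the kernel form has no zero on the diagonal and the matrices
`(g_{jk̄}(z)) = (g_{jk̄}(z, z̄))` are positive definite. -/
structure HasBergmanMetric : Prop where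
  kernel_ne_zero : ∀ x : M, bergmanKernel φ x x ≠ 0
  posDef : ∀ e ∈ holCharts (n := n) M, ∀ x ∈ e.source, (metricMatrix φ e e (e x) (e x)).PosDef

/-- `Z_0^p = {x : K(x, p̄) = 0}`. -/
def zeroSet (p : M) : Set M := {x | bergmanKernel φ x p = 0}

/-- `Z_1^p = {x ∈ M - Z_0^p : det G(x, p̄) = 0}`. Vanishing of the determinant does not depend on the
coordinates; the preferred charts at `x` and `p` are used. -/
def degenerateSet (p : M) : Set M :=
  {x | x ∉ zeroSet φ p ∧
    (metricMatrix φ (chartAt (CSpace n) x) (chartAt (CSpace n) p)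
      (chartAt (CSpace n) x x) (chartAt (CSpace n) p p)).det = 0}

/-- `M^p = M - (Z_0^p ∪ Z_1^p)`. -/
def regularSet (p : M) : Set M := (zeroSet φ p ∪ degenerateSet φ p)ᶜ

/-- The Bergman representative map at `p`, as a map on `M - Z_0^p`, for the coordinate system `e'`
at `p`:
`ζ_j(x) = ∑_k g^{k̄j}(p) (∂/∂w̄_k|_{w=p} log K*(x, w̄) - ∂/∂w̄_k|_{w=p} log K*(p, w̄))`. The first
term does not depend on the coordinates at `x`. -/
def bergmanRep (p : M) (e' : OpenPartialHomeomorph M (CSpace n)) (x : M) : CSpace n :=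
  fun j => ∑ k, (metricMatrix φ e' e' (e' p) (e' p))⁻¹ k j *
    (dbarLogKernel φ (chartAt (CSpace n) x) e' k (chartAt (CSpace n) x x) (e' p) -
      dbarLogKernel φ e' e' k (e' p) (e' p))

/-! ### The Bochner connection and its exponential map -/

/-- The Christoffel symbols `Γ^j_{kl}(z, p̄) = ∑_m ∂g_{km̄}(z, p̄)/∂z_l · g^{m̄j}(z, p̄)` in the
coordinate system `e` of the Bochner connection `∇^p` on `M^p`. They do not depend on the
coordinates at `p`. -/
def christoffel (p : M) (e : OpenPartialHomeomorph M (CSpace n)) (z : CSpace n)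
    (j k l : Fin n) : ℂ :=
  ∑ m, dz l (fun z' => metricMatrix φ e (chartAt (CSpace n) p) z' (chartAt (CSpace n) p p) k m) z *
    (metricMatrix φ e (chartAt (CSpace n) p) z (chartAt (CSpace n) p p))⁻¹ m j

/-- `γ`, restricted to the open set `J` of times, is a geodesic of `∇^p`: a curve in `M^p` that
solves `z_j'' + ∑_{k,l} Γ^j_{kl}(z, p̄) z_k' z_l' = 0` in all local coordinates. -/
structure IsGeodesicOn (p : M) (γ : ℝ → M) (J : Set ℝ) : Prop where
  continuousOn : ContinuousOn γ J
  mem_regularSet : ∀ t ∈ J, γ t ∈ regularSet φ p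
  differentiable : ∀ e ∈ holCharts (n := n) M, ∀ t ∈ J, γ t ∈ e.source →
    DifferentiableAt ℝ (fun s => e (γ s)) t
  equation : ∀ e ∈ holCharts (n := n) M, ∀ t ∈ J, γ t ∈ e.source →
    HasDerivAt (deriv fun s => e (γ s))
      (fun j => -∑ k, ∑ l, christoffel φ p e (e (γ t)) j k l *
        deriv (fun s => e (γ s)) t k * deriv (fun s => e (γ s)) t l) t

/-- `x = γ(1)` for a geodesic `γ` of `∇^p` with `γ(0) = q` and `γ'(0) = ζ`, defined on an open
interval that contains `[0, 1]`. -/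
def IsGeodesicEndpoint (p q : M) (ζ : TangentSpace 𝓘(ℂ, CSpace n) q) (x : M) : Prop :=
  ∃ (γ : ℝ → M) (J : Set ℝ), IsOpen J ∧ J.OrdConnected ∧ Set.Icc 0 1 ⊆ J ∧
    IsGeodesicOn φ p γ J ∧ γ 0 = q ∧
    (∀ e ∈ holCharts (n := n) M, q ∈ e.source →
      HasDerivAt (fun s => e (γ s)) (chartCoord e q ζ) 0) ∧
    γ 1 = x

/-- The domain of the affine exponential map of `∇^p` at `q`. -/
def exphDomain (p q : M) : Set (TangentSpace 𝓘(ℂ, CSpace n) q) :=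
  {ζ | ∃ x, IsGeodesicEndpoint φ p q ζ x}

open Classical in
/-- The affine exponential map `exph_q` of `∇^p` at `q` (with a junk value off its domain). -/
def exph (p q : M) (ζ : TangentSpace 𝓘(ℂ, CSpace n) q) : M :=
  if h : ∃ x, IsGeodesicEndpoint φ p q ζ x then h.choose else q

/-- The image of `exph_q`. -/
def exphImage (p q : M) : Set M := exph φ p q '' exphDomain φ p q

/-- The inverse map of `exph_q`, on the image of `exph_q`. -/
def exphInv (p q : M) : M → TangentSpace 𝓘(ℂ, CSpace n) q :=
  Function.invFunOn (exph φ p q) (exphDomain φ p q)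

end Kernel

/-! ### Complex affine structures -/

section Affine

variable {n : ℕ} {M : Type*} [TopologicalSpace M] [ChartedSpace (CSpace n) M]

/-- Affine atlases of the open subset `X` of `M`: holomorphic charts that cover `X`, all of whose
transition maps are complex affine transformations. -/
structure IsAffineAtlas (X : Set M) (𝒜 : Set (OpenPartialHomeomorph M (CSpace n))) : Prop where
  subset_holCharts : 𝒜 ⊆ holCharts (n := n) M
  source_subset : ∀ e ∈ 𝒜, e.source ⊆ X
  covers : ∀ x ∈ X, ∃ e ∈ 𝒜, x ∈ e.source
  affine : ∀ e ∈ 𝒜, ∀ e' ∈ 𝒜, ∃ T : CSpace n ≃ᵃ[ℂ] CSpace n,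
    Set.EqOn (e.symm.trans e') T (e.symm.trans e').source

/-- Complex affine structures on the open subset `X` of `M`: the maximal affine atlases. -/
def IsAffineStructure (X : Set M) (𝒜 : Set (OpenPartialHomeomorph M (CSpace n))) : Prop :=
  Maximal (IsAffineAtlas X) 𝒜

end Affine

end BergmanGeometry

end

open BergmanGeometry

/-!
The derivatives `b_k(x) = ∂/∂w̄_k|_{w=p} log K*(x, w̄)` form a map `b` (`repMap`) from the
complement of the zeros of `K(·, p̄)` to `ℂⁿ`, independent of the coordinates at `x`. Its derivative in local
coordinates is the matrix `G(z, p̄)` (`metricMatrix_eq_jacobian`), so `M^p` is the open set on which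
`b` is locally biholomorphic (`isDevelopingMap_repMap`). Since the coefficients `∂g_{km̄}/∂z_l` are
then the second derivatives of `b`, the equation of the geodesics of the Bochner connection says
that `(b ∘ γ)'' = 0` (`fderiv_christoffel`). The geodesics are therefore the lifts through `b` of
the real lines of `ℂⁿ` (`isGeodesicEndpoint_iff`): with `L` the derivative of `b` at `q`,
`b (exph_q ζ) = b q + L ζ`.

All the assertions follow from this identity. The exponential map is injective with inverse
`x ↦ L⁻¹ (b x - b q)`, and a change of the coordinates at `p` changes `b` by an affine map
(`exists_repMap_eq_affine`); this gives the explicit formulas and the affine relations. Its domain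
and image are open because a line segment lifted through a local homeomorphism has a neighbourhood
on which the local homeomorphism is injective, in which all nearby segments can be lifted
(`IsLocalHomeoOn.exists_isOpen_lineLiftEnd`). The charts that are affine functions of `b` form an
affine atlas, which Zorn's lemma enlarges to a maximal one; in each chart of it `b` is locally
affine, so that its second derivatives, and with them the Christoffel symbols, vanish.

The analytic input is the regularity of the kernel. By the mean value inequality and Bessel's
inequality the coefficients of an orthonormal basis of `A²(M)` are square summable at each point,
with locally bounded sums (`exists_ball_sum_norm_sq_le`). They form a holomorphic map `Φ_e` to `ℓ²`
(`differentiableOn_coeffVector`), and `K*(z, w̄) = ⟪Φ_{e'}(w), Φ_e(z)⟫`, which allows all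
differentiations of the series. Holomorphic maps of several variables are shown to be analytic by
Cauchy's estimates (`analyticAt_of_differentiableOn`).
-/

namespace BergmanGeometry

open Metric Set Filter MeasureTheory
open scoped ENNReal

/-! ### Holomorphic functions of several variables -/

section SeveralVariables

variable {E F : Type*} [NormedAddCommGroup E] [NormedSpace ℂ E] [NormedAddCommGroup F]
  [NormedSpace ℂ F]

lemma norm_fderiv_le_of_bound {f : E → F} {c : E} {R C : ℝ} (hR : 0 < R)
    (hd : DifferentiableOn ℂ f (ball c R)) (hC : ∀ z ∈ ball c R, ‖f z‖ ≤ C) :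
    ‖fderiv ℂ f c‖ ≤ 2 * C / R := by
  refine Complex.norm_fderiv_le_div_of_mapsTo_ball hd (fun z hz => ?_) hR
  rw [mem_closedBall, dist_eq_norm]
  linarith [norm_sub_le (f z) (f c), hC z hz, hC c (mem_ball_self hR)]

/-- The second-order Taylor estimate for bounded holomorphic functions, with a constant that
depends only on the bound. It comes from the Schwarz lemma, applied to `f - Df(c)`. -/
lemma norm_sub_sub_fderiv_le {f : E → F} {c : E} {R C : ℝ} (hR : 0 < R)
    (hd : DifferentiableOn ℂ f (ball c R)) (hC : ∀ z ∈ ball c R, ‖f z‖ ≤ C) {z : E}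
    (hz : z ∈ ball c R) :
    ‖f z - f c - fderiv ℂ f c (z - c)‖ ≤ 4 * C / R ^ 2 * ‖z - c‖ ^ 2 := by
  have hL := norm_fderiv_le_of_bound hR hd hC
  have hc : DifferentiableAt ℂ f c :=
    (hd c (mem_ball_self hR)).differentiableAt (ball_mem_nhds c hR)
  have key := Complex.dist_le_mul_div_pow_of_mapsTo_ball_of_isLittleO (n := 1)
    (f := fun w => f w - fderiv ℂ f c (w - c)) (R₂ := 4 * C) (c := c) (R₁ := R) (z := z)
    (hd.sub (by fun_prop)) (fun w hw => ?_) ?_ hz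
  · rw [dist_eq_norm, dist_eq_norm] at key
    calc _ = ‖f z - fderiv ℂ f c (z - c) - (f c - fderiv ℂ f c (c - c))‖ := by
          simp; congr 1; abel
      _ ≤ _ := key
      _ = _ := by rw [one_add_one_eq_two, div_pow]; ring
  · rw [mem_closedBall, dist_eq_norm]
    have h1 : ‖fderiv ℂ f c (w - c)‖ ≤ 2 * C := by
      refine ((fderiv ℂ f c).le_of_opNorm_le hL _).trans ?_
      rw [mem_ball, dist_eq_norm] at hw
      have : 0 ≤ C := (norm_nonneg _).trans (hC c (mem_ball_self hR))
      calc 2 * C / R * ‖w - c‖ ≤ 2 * C / R * R := by gcongr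
        _ = _ := by field_simp
    simp only [sub_self, map_zero, sub_zero]
    have := norm_sub_le (f w - f c) (fderiv ℂ f c (w - c))
    have h2 := norm_sub_le (f w) (f c)
    have h3 := hC w hw
    have h4 := hC c (mem_ball_self hR)
    rw [sub_right_comm]; linarith
  · have := hc.hasFDerivAt.isLittleO
    simp only [pow_one, sub_self, map_zero, sub_zero]
    refine (this.congr_left fun w => by abel).trans_isBigO ?_
    exact (Asymptotics.isBigO_refl _ _).norm_right

/-- A pointwise limit of uniformly bounded holomorphic functions, whose derivatives at the centre
converge pointwise to a continuous linear map, is differentiable at the centre. -/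
lemma hasFDerivAt_of_tendsto_of_bound {α : Type*} {l : Filter α} [l.NeBot] {f : α → E → F}
    {g : E → F} {L : E →L[ℂ] F} {c : E} {R C : ℝ} (hR : 0 < R)
    (hd : ∀ᶠ i in l, DifferentiableOn ℂ (f i) (ball c R))
    (hC : ∀ᶠ i in l, ∀ z ∈ ball c R, ‖f i z‖ ≤ C)
    (hf : ∀ z ∈ ball c R, Tendsto (fun i => f i z) l (𝓝 (g z)))
    (hL : ∀ h, Tendsto (fun i => fderiv ℂ (f i) c h) l (𝓝 (L h))) : HasFDerivAt g L c := by
  have key : ∀ z ∈ ball c R, ‖g z - g c - L (z - c)‖ ≤ 4 * C / R ^ 2 * ‖z - c‖ ^ 2 := fun z hz =>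
    le_of_tendsto (((hf z hz).sub (hf c (mem_ball_self hR))).sub (hL _)).norm <| by
      filter_upwards [hd, hC] with i hi hi'
      exact norm_sub_sub_fderiv_le hR hi hi' hz
  rw [hasFDerivAt_iff_isLittleO]
  refine Asymptotics.IsBigO.trans_isLittleO (g := fun z => ‖z - c‖ ^ 2) ?_ ?_
  · refine Asymptotics.IsBigO.of_bound (4 * C / R ^ 2) ?_
    filter_upwards [ball_mem_nhds c hR] with z hz
    simpa using key z hz
  · have : Tendsto (fun z => z - c) (𝓝 c) (𝓝 0) := by
      have : Continuous fun z => z - c := by fun_prop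
      simpa using this.tendsto c
    exact (Asymptotics.isLittleO_norm_pow_id one_lt_two).comp_tendsto this

lemma exists_ball_subset_bound {E F : Type*} [SeminormedAddCommGroup E]
    [SeminormedAddCommGroup F] {f : E → F} {U : Set E} {c : E} (hU : IsOpen U) (hc : c ∈ U)
    (hf : ContinuousOn f U) : ∃ R > 0, ∃ C, ball c R ⊆ U ∧ ∀ z ∈ ball c R, ‖f z‖ ≤ C := by
  have h1 : ∀ᶠ z in 𝓝 c, ‖f z‖ < ‖f c‖ + 1 :=
    (hf.continuousAt (hU.mem_nhds hc)).norm.eventually_lt_const (by linarith)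
  obtain ⟨R, hR, h⟩ := Metric.mem_nhds_iff.1 (inter_mem (hU.mem_nhds hc) h1)
  exact ⟨R, hR, ‖f c‖ + 1, fun z hz => (h hz).1, fun z hz => (h hz).2.le⟩

/-- The directional derivatives of a holomorphic function are holomorphic, as locally uniform
limits of difference quotients. -/
lemma differentiableOn_fderiv_apply [CompleteSpace F] {f : E → F} {U : Set E} (hU : IsOpen U)
    (hf : DifferentiableOn ℂ f U) (v : E) : DifferentiableOn ℂ (fun z => fderiv ℂ f z v) U := by
  intro c hc
  obtain ⟨R, hR, C, hRU, hC⟩ := exists_ball_subset_bound hU hc hf.continuousOn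
  have hC0 : 0 ≤ C := (norm_nonneg _).trans (hC c (mem_ball_self hR))
  set r := R / 4 with hr
  have hr0 : 0 < r := by positivity
  have hsub : ∀ z ∈ ball c (2 * r), ball z (2 * r) ⊆ ball c R := fun z hz w hw => by
    rw [mem_ball] at *
    linarith [dist_triangle w z c]
  have hdz : ∀ z ∈ ball c (2 * r), DifferentiableOn ℂ f (ball z (2 * r)) := fun z hz =>
    hf.mono ((hsub z hz).trans hRU)
  set q : ℂ → E → F := fun t z => t⁻¹ • (f (z + t • v) - f z) with hq
  -- the difference quotients converge uniformly, with an error of order `|t|`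
  have hq1 : ∀ t : ℂ, t ≠ 0 → ‖t • v‖ < r → ∀ z ∈ ball c (2 * r),
      ‖q t z - fderiv ℂ f z v‖ ≤ 4 * C / (2 * r) ^ 2 * ‖v‖ ^ 2 * ‖t‖ := by
    intro t ht htv z hz
    have h1 := norm_sub_sub_fderiv_le (by positivity) (hdz z hz)
      (fun w hw => hC w (hsub z hz hw)) (z := z + t • v) (by
        rw [mem_ball, dist_eq_norm]; simpa using by linarith)
    have h2 : q t z - fderiv ℂ f z v =
        t⁻¹ • (f (z + t • v) - f z - fderiv ℂ f z (z + t • v - z)) := by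
      simp only [hq, add_sub_cancel_left, map_smul, smul_sub]
      rw [inv_smul_smul₀ ht]
    rw [h2, norm_smul, norm_inv]
    simp only [add_sub_cancel_left] at h1 ⊢
    rw [norm_smul] at h1
    have ht' : 0 < ‖t‖ := norm_pos_iff.2 ht
    calc _ ≤ ‖t‖⁻¹ * (4 * C / (2 * r) ^ 2 * (‖t‖ * ‖v‖) ^ 2) := by gcongr
      _ = _ := by field_simp
  set K := 4 * C / (2 * r) ^ 2 * ‖v‖ ^ 2 with hK
  have hK0 : 0 ≤ K := by positivity
  have hqd : ∀ t : ℂ, ‖t • v‖ < r → DifferentiableOn ℂ (q t) (ball c r) := by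
    intro t ht
    refine DifferentiableOn.const_smul (DifferentiableOn.sub ?_ ?_) _
    · refine hf.comp (by fun_prop) fun z hz => hRU ?_
      rw [mem_ball, dist_eq_norm] at *
      have := norm_add_le (z - c) (t • v)
      rw [show z + t • v - c = z - c + t • v by abel]; linarith
    · exact hf.mono fun z hz => hRU (ball_subset_ball (by linarith) hz)
  -- the derivatives at `c` of the difference quotients form a Cauchy net, by Cauchy's estimate
  have hev : ∀ᶠ t : ℂ in 𝓝[≠] 0, t ≠ 0 ∧ ‖t • v‖ < r := by
    refine eventually_mem_nhdsWithin.and (nhdsWithin_le_nhds ?_)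
    have : Tendsto (fun t : ℂ => ‖t • v‖) (𝓝 0) (𝓝 0) := by
      have : Continuous fun t : ℂ => ‖t • v‖ := by fun_prop
      simpa using this.tendsto 0
    exact this.eventually_lt_const hr0
  have hmemc : c ∈ ball c r := mem_ball_self hr0
  have hsmall : ball c r ⊆ ball c (2 * r) := ball_subset_ball (by linarith)
  have hcau : Cauchy (map (fun t => fderiv ℂ (q t) c) (𝓝[≠] (0 : ℂ))) := by
    rw [Metric.cauchy_iff]
    refine ⟨inferInstance, fun ε hε => ?_⟩
    have hev2 : ∀ᶠ t : ℂ in 𝓝[≠] 0, 4 * K / r * ‖t‖ < ε := by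
      refine nhdsWithin_le_nhds ?_
      have : Tendsto (fun t : ℂ => 4 * K / r * ‖t‖) (𝓝 0) (𝓝 0) := by
        have : Continuous fun t : ℂ => 4 * K / r * ‖t‖ := by fun_prop
        simpa using this.tendsto 0
      exact this.eventually_lt_const hε
    refine ⟨_, image_mem_map (hev.and hev2), ?_⟩
    rintro _ ⟨t, ⟨⟨ht0, htr⟩, ht⟩, rfl⟩ _ ⟨s, ⟨⟨hs0, hsr⟩, hs⟩, rfl⟩
    rw [dist_eq_norm, ← fderiv_sub ((hqd t htr c hmemc).differentiableAt (ball_mem_nhds c hr0))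
      ((hqd s hsr c hmemc).differentiableAt (ball_mem_nhds c hr0))]
    have := norm_fderiv_le_of_bound (C := K * ‖t‖ + K * ‖s‖) hr0 ((hqd t htr).sub (hqd s hsr))
      fun z hz => by
        have h1 := hq1 t ht0 htr z (hsmall hz)
        have h2 := hq1 s hs0 hsr z (hsmall hz)
        calc ‖q t z - q s z‖ = ‖(q t z - fderiv ℂ f z v) - (q s z - fderiv ℂ f z v)‖ := by
              congr 1; abel
          _ ≤ _ := (norm_sub_le _ _).trans (add_le_add h1 h2)
    refine this.trans_lt ?_
    have e : 2 * (K * ‖t‖ + K * ‖s‖) / r = (4 * K / r * ‖t‖ + 4 * K / r * ‖s‖) / 2 := by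
      field_simp; ring
    rw [e]; linarith
  obtain ⟨L, hL⟩ := CompleteSpace.complete hcau
  refine (hasFDerivAt_of_tendsto_of_bound (l := 𝓝[≠] (0 : ℂ)) (f := q) (L := L) (R := r)
    (C := 2 * C / (2 * r) * ‖v‖ + K) hr0 ?_ ?_ ?_ ?_).differentiableAt.differentiableWithinAt
  · filter_upwards [hev] with t ht using hqd t ht.2
  · have hev3 : ∀ᶠ t : ℂ in 𝓝[≠] 0, ‖t‖ < 1 := by
      refine nhdsWithin_le_nhds ?_
      exact ((continuous_norm (E := ℂ)).tendsto 0).eventually_lt_const (by simp)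
    filter_upwards [hev, hev3] with t ht ht1 z hz
    have h1 := hq1 t ht.1 ht.2 z (hsmall hz)
    have h2 := (fderiv ℂ f z).le_of_opNorm_le (norm_fderiv_le_of_bound (by positivity)
      (hdz z (hsmall hz)) fun w hw => hC w (hsub z (hsmall hz) hw)) v
    have h3 : K * ‖t‖ ≤ K := mul_le_of_le_one_right hK0 ht1.le
    have h4 := norm_add_le (q t z - fderiv ℂ f z v) (fderiv ℂ f z v)
    rw [sub_add_cancel] at h4
    linarith
  · intro z hz
    rw [tendsto_iff_norm_sub_tendsto_zero]
    refine squeeze_zero' (g := fun t : ℂ => K * ‖t‖)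
      (Eventually.of_forall fun _ => norm_nonneg _) ?_ ?_
    · filter_upwards [hev] with t ht using hq1 t ht.1 ht.2 z (hsmall hz)
    · refine tendsto_nhdsWithin_of_tendsto_nhds ?_
      have : Continuous fun t : ℂ => K * ‖t‖ := by fun_prop
      simpa using this.tendsto 0
  · intro h
    exact ((ContinuousLinearMap.apply ℂ F h).continuous.tendsto L).comp hL

end SeveralVariables

section Analyticity

universe u

variable {E F : Type u} [NormedAddCommGroup E] [NormedSpace ℂ E] [NormedAddCommGroup F]
  [NormedSpace ℂ F]

lemma differentiableOn_fderiv [FiniteDimensional ℂ E] [CompleteSpace F] {f : E → F} {U : Set E}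
    (hU : IsOpen U) (hf : DifferentiableOn ℂ f U) : DifferentiableOn ℂ (fderiv ℂ f) U := by
  let b := Module.finBasis ℂ E
  have e : fderiv ℂ f = fun z => ∑ i, (LinearMap.toContinuousLinearMap (b.coord i)).smulRight
      (fderiv ℂ f z (b i)) := by
    ext z v
    conv_lhs => rw [← b.sum_repr v, map_sum]
    simp
  rw [e]
  refine DifferentiableOn.fun_sum fun i _ => ?_
  exact (ContinuousLinearMap.smulRightL ℂ E F _).differentiable.comp_differentiableOn
    (differentiableOn_fderiv_apply hU hf (b i))

lemma contDiffOn_nat_of_differentiableOn [FiniteDimensional ℂ E] {U : Set E} (hU : IsOpen U)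
    (m : ℕ) : ∀ {F : Type u} [NormedAddCommGroup F] [NormedSpace ℂ F] [CompleteSpace F] {f : E → F},
    DifferentiableOn ℂ f U → ContDiffOn ℂ m f U := by
  induction m with
  | zero => intro F _ _ _ f hf; simpa using hf.continuousOn
  | succ m ih =>
    intro F _ _ _ f hf
    push_cast
    rw [contDiffOn_succ_iff_fderiv_of_isOpen hU]
    exact ⟨hf, fun h => absurd h (by simp), ih (differentiableOn_fderiv hU hf)⟩

/-- Cauchy's estimate for the higher derivatives, by iteration of the estimate for the first one
on balls of radii `R, R - R / m, R - 2 R / m, …`. -/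
lemma norm_iteratedFDeriv_le_of_bound [FiniteDimensional ℂ E] (m : ℕ) :
    ∀ {F : Type u} [NormedAddCommGroup F] [NormedSpace ℂ F] [CompleteSpace F] {f : E → F} {c : E}
      {R C : ℝ}, 0 < R → DifferentiableOn ℂ f (ball c R) → (∀ z ∈ ball c R, ‖f z‖ ≤ C) →
      ‖iteratedFDeriv ℂ m f c‖ ≤ C * (2 * m / R) ^ m := by
  induction m with
  | zero =>
    intro F _ _ _ f c R C hR hf hC
    simpa using hC c (mem_ball_self hR)
  | succ m ih =>
    intro F _ _ _ f c R C hR hf hC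
    set δ := R / (m + 1) with hδ
    have hδ0 : 0 < δ := by positivity
    have hC0 : 0 ≤ C := (norm_nonneg _).trans (hC c (mem_ball_self hR))
    rw [← norm_iteratedFDeriv_fderiv]
    rcases Nat.eq_zero_or_pos m with rfl | hm
    · simp only [norm_iteratedFDeriv_zero]
      refine (norm_fderiv_le_of_bound hR hf hC).trans_eq ?_
      simp; ring
    have hlt : 0 < R - δ := by
      have : (1 : ℝ) ≤ m := by exact_mod_cast hm
      rw [hδ, sub_pos, div_lt_iff₀ (by positivity)]; nlinarith
    have key := ih (f := fderiv ℂ f) (c := c) (R := R - δ) (C := 2 * C / δ) hlt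
      ((differentiableOn_fderiv isOpen_ball hf).mono (ball_subset_ball (by linarith)))
      fun z hz => by
        have hsub : ball z δ ⊆ ball c R := fun w hw => by
          rw [mem_ball] at *; linarith [dist_triangle w z c]
        exact norm_fderiv_le_of_bound hδ0 (hf.mono hsub) fun w hw => hC w (hsub hw)
    refine key.trans_eq ?_
    have e : R - δ = R * m / (m + 1) := by rw [hδ]; field_simp; ring
    rw [e, hδ, pow_succ]
    have hm' : (m : ℝ) ≠ 0 := by positivity
    push_cast
    field_simp

/-- A holomorphic function of several variables is analytic. The Taylor coefficients at `c` are
bounded by Cauchy's estimates together with `m ^ m ≤ m! * exp m`, and the Taylor series sums to the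
function because it does so on each complex line through `c`. -/
lemma analyticAt_of_differentiableOn [FiniteDimensional ℂ E] [CompleteSpace F] {f : E → F}
    {U : Set E} (hU : IsOpen U) (hf : DifferentiableOn ℂ f U) {c : E} (hc : c ∈ U) :
    AnalyticAt ℂ f c := by
  obtain ⟨R, hR, C, hRU, hC⟩ := exists_ball_subset_bound hU hc hf.continuousOn
  have hC0 : 0 ≤ C := (norm_nonneg _).trans (hC c (mem_ball_self hR))
  replace hf := hf.mono hRU
  let p : FormalMultilinearSeries ℂ E F := fun m => (m.factorial : ℂ)⁻¹ • iteratedFDeriv ℂ m f c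
  set r : ℝ := R / (2 * Real.exp 1) with hr
  have hr0 : 0 < r := by positivity
  have hrR : r ≤ R := by
    rw [hr, div_le_iff₀ (by positivity)]
    nlinarith [Real.add_one_le_exp (1 : ℝ)]
  refine ⟨p, ENNReal.ofReal r, ?_, by simpa using hr0, ?_⟩
  · rw [ENNReal.ofReal]
    refine p.le_radius_of_bound C fun m => ?_
    rw [Real.coe_toNNReal r hr0.le]
    have h1 := norm_iteratedFDeriv_le_of_bound m hR hf hC
    have h2 : (m : ℝ) ^ m / m.factorial ≤ Real.exp 1 ^ m := by
      rw [← Real.exp_nat_mul, mul_one]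
      exact Real.pow_div_factorial_le_exp _ (by positivity) m
    simp only [p, norm_smul, norm_inv, Complex.norm_natCast]
    calc (m.factorial : ℝ)⁻¹ * ‖iteratedFDeriv ℂ m f c‖ * r ^ m
        ≤ (m.factorial : ℝ)⁻¹ * (C * (2 * m / R) ^ m) * r ^ m := by gcongr
      _ = C * ((m : ℝ) ^ m / m.factorial) * (2 / R * r) ^ m := by
        rw [mul_div_right_comm, mul_pow, mul_pow]; ring
      _ ≤ C * Real.exp 1 ^ m * (2 / R * r) ^ m := by gcongr
      _ = C * (Real.exp 1 * (2 / R * r)) ^ m := by rw [mul_assoc, ← mul_pow]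
      _ = C := by rw [hr]; field_simp; simp
  · intro y hy
    have hy' : ‖y‖ < R := by
      have : ‖y‖ < r := by simpa [Metric.eball_ofReal] using hy
      linarith
    -- restriction to the complex line through `c` in the direction `y`
    let g : ℂ →L[ℂ] E := ContinuousLinearMap.toSpanSingleton ℂ y
    set s : Set E := ball 0 R with hs
    have hsub : MapsTo (fun z => c + z) s (ball c R) := fun z hz => by
      simpa [hs, mem_ball, dist_eq_norm] using hz
    have hfs : DifferentiableOn ℂ (fun z => f (c + z)) s := hf.comp (by fun_prop) hsub
    have hso : IsOpen s := isOpen_ball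
    have hgo : IsOpen (g ⁻¹' s) := hso.preimage g.continuous
    have h0 : g 0 ∈ s := by simpa [hs] using hR
    have hiter : ∀ m : ℕ, iteratedDeriv m (fun t : ℂ => f (c + t • y)) 0 =
        iteratedFDeriv ℂ m f c fun _ => y := by
      intro m
      have h1 := g.iteratedFDerivWithin_comp_right
        (contDiffOn_nat_of_differentiableOn hso m hfs) hso.uniqueDiffOn hgo.uniqueDiffOn h0 le_rfl
      rw [iteratedFDerivWithin_of_isOpen m hgo (by simpa using h0),
        iteratedFDerivWithin_of_isOpen m hso h0] at h1
      have h2 : (fun z => f (c + z)) ∘ g = fun t : ℂ => f (c + t • y) := by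
        ext t; simp [g]
      rw [h2] at h1
      rw [iteratedDeriv_eq_iteratedFDeriv, h1]
      simp [iteratedFDeriv_comp_add_left, g]
    obtain ⟨ρ, hρ1, hρ⟩ : ∃ ρ, 1 < ρ ∧ ρ * ‖y‖ < R := by
      have : 0 < ‖y‖ + R := by positivity
      refine ⟨2 * R / (‖y‖ + R), ?_, ?_⟩
      · rw [lt_div_iff₀ this]; linarith
      · rw [div_mul_eq_mul_div, div_lt_iff₀ this]; nlinarith
    have hone : (1 : ℂ) ∈ ball (0 : ℂ) ρ := by simpa using hρ1
    have hline : DifferentiableOn ℂ (fun t : ℂ => f (c + t • y)) (ball 0 ρ) := by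
      refine hfs.comp (by fun_prop) fun t ht => ?_
      rw [mem_ball_zero_iff] at ht
      rw [hs, mem_ball_zero_iff, norm_smul]
      exact (mul_le_mul_of_nonneg_right ht.le (norm_nonneg y)).trans_lt hρ
    have hsum := Complex.hasSum_taylorSeries_on_ball hline hone
    simpa [hiter, p] using hsum

lemma contDiffOn_of_differentiableOn [FiniteDimensional ℂ E] [CompleteSpace F] {f : E → F}
    {U : Set E} (hU : IsOpen U) (hf : DifferentiableOn ℂ f U) (m : WithTop ℕ∞) :
    ContDiffOn ℂ m f U := fun _ hc =>
  (analyticAt_of_differentiableOn hU hf hc).contDiffAt.contDiffWithinAt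

end Analyticity

/-! ### Holomorphic maps into `ℓ²` -/

section SquareSummable

variable {ι E : Type*}

lemma memℓp_two_of_sum_le {a : ι → ℂ} {C : ℝ} (h : ∀ s : Finset ι, ∑ i ∈ s, ‖a i‖ ^ 2 ≤ C) :
    Memℓp a 2 :=
  memℓp_gen' (C := C) fun s => by simpa using h s

open Classical in
/-- The vector in `ℓ²` with entries `a i`, or `0` if these are not square summable. -/
noncomputable def toL2 (a : ι → ℂ) : lp (fun _ : ι => ℂ) 2 :=
  if h : Memℓp a 2 then ⟨a, h⟩ else 0

lemma toL2_apply {a : ι → ℂ} (h : Memℓp a 2) (i : ι) : toL2 a i = a i := by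
  rw [toL2, dif_pos h]

lemma norm_toL2_sq_le {a : ι → ℂ} {C : ℝ} (h : ∀ s : Finset ι, ∑ i ∈ s, ‖a i‖ ^ 2 ≤ C) :
    ‖toL2 a‖ ^ 2 ≤ C := by
  have hm := memℓp_two_of_sum_le h
  have := lp.norm_rpow_eq_tsum (p := 2) (by simp) (toL2 a)
  simp only [ENNReal.toReal_ofNat, Real.rpow_ofNat, toL2_apply hm] at this
  rw [this]
  exact Real.tsum_le_of_sum_le (fun _ => by positivity) h

lemma sum_norm_sq_le_of_norm_le [DecidableEq ι] {s : Finset ι} {a : ι → ℂ} {C : ℝ}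
    (h : ‖∑ i ∈ s, lp.single (E := fun _ : ι => ℂ) 2 i (a i)‖ ≤ C) :
    ∑ i ∈ s, ‖a i‖ ^ 2 ≤ C ^ 2 := by
  have := lp.norm_sum_single (p := 2) (E := fun _ : ι => ℂ) (by simp) a s
  simp only [ENNReal.toReal_ofNat, Real.rpow_ofNat] at this
  rw [← this]
  gcongr

/-- A locally bounded map into `ℓ²` with holomorphic entries is holomorphic. -/
lemma differentiableOn_toL2 [NormedAddCommGroup E] [NormedSpace ℂ E] {U : Set E}
    {a : ι → E → ℂ} (ha : ∀ i, DifferentiableOn ℂ (a i) U)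
    (hb : ∀ c ∈ U, ∃ R > 0, ∃ C, ball c R ⊆ U ∧
      ∀ z ∈ ball c R, ∀ s : Finset ι, ∑ i ∈ s, ‖a i z‖ ^ 2 ≤ C) :
    DifferentiableOn ℂ (fun z => toL2 fun i => a i z) U := by
  classical
  intro c hc
  obtain ⟨R, hR, C, hRU, hC⟩ := hb c hc
  have hC0 : 0 ≤ C := by simpa using hC c (mem_ball_self hR) ∅
  let f : Finset ι → E → lp (fun _ : ι => ℂ) 2 := fun s z => ∑ i ∈ s, lp.single 2 i (a i z)
  have hda : ∀ i, ∀ z ∈ ball c R, DifferentiableAt ℂ (a i) z := fun i z hz =>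
    ((ha i).mono hRU).differentiableAt (isOpen_ball.mem_nhds hz)
  have hfd : ∀ s, ∀ z ∈ ball c R, HasFDerivAt (f s)
      (∑ i ∈ s, (lp.singleContinuousLinearMap ℂ (fun _ : ι => ℂ) 2 i).comp (fderiv ℂ (a i) z)) z :=
    fun s z hz => HasFDerivAt.fun_sum fun i _ =>
      (lp.singleContinuousLinearMap ℂ (fun _ : ι => ℂ) 2 i).hasFDerivAt.comp z
        (hda i z hz).hasFDerivAt
  have hfb : ∀ s, ∀ z ∈ ball c R, ‖f s z‖ ≤ √C := by
    intro s z hz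
    refine Real.le_sqrt_of_sq_le ?_
    have := lp.norm_sum_single (p := 2) (E := fun _ : ι => ℂ) (by simp) (fun i => a i z) s
    simp only [ENNReal.toReal_ofNat, Real.rpow_ofNat] at this
    rw [this]
    exact hC z hz s
  have hfdo : ∀ s, DifferentiableOn ℂ (f s) (ball c R) := fun s z hz =>
    (hfd s z hz).differentiableAt.differentiableWithinAt
  have hfa : ∀ s h, fderiv ℂ (f s) c h = ∑ i ∈ s, lp.single 2 i (fderiv ℂ (a i) c h) := by
    intro s h
    rw [(hfd s c (mem_ball_self hR)).fderiv]
    simp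
  -- the derivatives of the entries are square summable, by Cauchy's estimate for the truncations
  have hsum : ∀ h, ∀ s : Finset ι, ∑ i ∈ s, ‖fderiv ℂ (a i) c h‖ ^ 2 ≤ (2 * √C / R * ‖h‖) ^ 2 := by
    intro h s
    refine sum_norm_sq_le_of_norm_le ?_
    rw [← hfa]
    exact (fderiv ℂ (f s) c).le_of_opNorm_le (norm_fderiv_le_of_bound hR (hfdo s) (hfb s)) h
  have hmem : ∀ h, Memℓp (fun i => fderiv ℂ (a i) c h) 2 := fun h => memℓp_two_of_sum_le (hsum h)
  let L : E →L[ℂ] lp (fun _ : ι => ℂ) 2 := LinearMap.mkContinuous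
    { toFun := fun h => toL2 fun i => fderiv ℂ (a i) c h
      map_add' := fun h k => by
        ext i
        have := toL2_apply (hmem (h + k)) i
        simp only [map_add] at this
        simp [toL2_apply (hmem _), this]
      map_smul' := fun t h => by
        ext i
        have := toL2_apply (hmem (t • h)) i
        simp only [map_smul, smul_eq_mul] at this
        simp [toL2_apply (hmem _), this] }
    (2 * √C / R) fun h => by
      refine le_of_sq_le_sq ?_ (by positivity)
      exact norm_toL2_sq_le (hsum h)
  have hlim : ∀ b : ι → ℂ, Memℓp b 2 →
      Tendsto (fun s : Finset ι => ∑ i ∈ s, lp.single (E := fun _ : ι => ℂ) 2 i (b i)) atTop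
        (𝓝 (toL2 b)) := by
    intro b hb
    have := lp.hasSum_single (p := 2) (by simp) (toL2 b)
    simp only [toL2_apply hb] at this
    exact this
  refine (hasFDerivAt_of_tendsto_of_bound (l := atTop) (f := f) (L := L) (C := √C) hR
    (Eventually.of_forall hfdo) (Eventually.of_forall hfb)
    (fun z hz => hlim _ (memℓp_two_of_sum_le (hC z hz)))
    fun h => ?_).differentiableAt.differentiableWithinAt
  simp only [hfa]
  exact hlim _ (hmem h)

end SquareSummable

/-! ### The mean value inequality -/

section MeanValue

variable {n : ℕ}

lemma measurePreserving_smul_of_norm_eq_one {c : ℂ} (hc : ‖c‖ = 1) :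
    MeasurePreserving (fun v : Fin n → ℂ => c • v) volume volume := by
  have h1 : MeasurePreserving (fun z : ℂ => c * z) volume volume :=
    (rotation ⟨c, mem_sphere_zero_iff_norm.2 hc⟩).measurePreserving
  exact volume_preserving_pi fun _ : Fin n => h1

lemma enorm_sq_le_lintegral_circle {f : ℂ → ℂ} (hf : DifferentiableOn ℂ f (closedBall 0 1)) :
    ENNReal.ofReal (2 * Real.pi) * ‖f 0‖ₑ ^ 2 ≤
      ∫⁻ θ in Ioc 0 (2 * Real.pi), ‖f (circleMap 0 1 θ)‖ₑ ^ 2 := by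
  have h1 : Real.circleAverage (fun z => f z ^ 2) 0 1 = f 0 ^ 2 := by
    refine DiffContOnCl.circleAverage ?_
    rw [abs_one]
    exact (hf.pow 2).diffContOnCl_ball le_rfl
  rw [Real.circleAverage_def, intervalIntegral.integral_of_le (by positivity)] at h1
  have h2 : ∫ θ in Ioc 0 (2 * Real.pi), f (circleMap 0 1 θ) ^ 2 = (2 * Real.pi) • f 0 ^ 2 := by
    rw [← h1, smul_inv_smul₀ (by positivity)]
  have h3 := enorm_integral_le_lintegral_enorm (μ := volume.restrict (Ioc 0 (2 * Real.pi)))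
    fun θ : ℝ => f (circleMap 0 1 θ) ^ 2
  rw [h2, enorm_smul, enorm_pow] at h3
  simp only [enorm_pow] at h3
  convert h3
  rw [Real.enorm_eq_ofReal (by positivity)]

/-- The mean value inequality for holomorphic functions on a ball: `‖f‖²` at the centre is at most
its average. It follows from the one-dimensional inequality on the discs `t ↦ f (c + t v)` by
integration over `v`, because multiplication by `t`, `|t| = 1`, preserves the volume. -/
lemma volume_ball_mul_enorm_sq_le {f : (Fin n → ℂ) → ℂ} {c : Fin n → ℂ} {r : ℝ}
    (hf : DifferentiableOn ℂ f (ball c r)) :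
    volume (ball (0 : Fin n → ℂ) r) * ‖f c‖ₑ ^ 2 ≤ ∫⁻ z in ball c r, ‖f z‖ₑ ^ 2 := by
  set g : (Fin n → ℂ) → ℝ≥0∞ := (ball 0 r).indicator fun v => ‖f (c + v)‖ₑ ^ 2 with hg
  have hsub : MapsTo (fun v => c + v) (ball 0 r) (ball c r) := fun v hv => by
    simpa [mem_ball, dist_eq_norm] using hv
  have hgm : Measurable g := by
    classical
    have h1 : ContinuousOn (fun v => ‖f (c + v)‖ₑ ^ 2) (ball 0 r) := by
      have : ContinuousOn (fun v => f (c + v)) (ball 0 r) :=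
        hf.continuousOn.comp (by fun_prop) hsub
      exact (ENNReal.continuous_pow 2).comp_continuousOn this.enorm
    rw [hg, ← Set.piecewise_eq_indicator]
    refine h1.measurable_piecewise continuousOn_const measurableSet_ball
  have hcm : Measurable fun q : (Fin n → ℂ) × ℝ => g (circleMap 0 1 q.2 • q.1) := by
    refine hgm.comp (Continuous.measurable ?_)
    exact ((continuous_circleMap 0 1).comp continuous_snd).smul continuous_fst
  have hdisc : ∀ v ∈ ball (0 : Fin n → ℂ) r, ENNReal.ofReal (2 * Real.pi) * ‖f c‖ₑ ^ 2 ≤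
      ∫⁻ θ in Ioc 0 (2 * Real.pi), g (circleMap 0 1 θ • v) := by
    intro v hv
    rw [mem_ball_zero_iff] at hv
    have hball : ∀ t ∈ closedBall (0 : ℂ) 1, t • v ∈ ball (0 : Fin n → ℂ) r := fun t ht => by
      rw [mem_closedBall_zero_iff] at ht
      rw [mem_ball_zero_iff, norm_smul]
      exact (mul_le_of_le_one_left (norm_nonneg v) ht).trans_lt hv
    have := enorm_sq_le_lintegral_circle (f := fun t => f (c + t • v))
      (hf.comp (by fun_prop) fun t ht => hsub (hball t ht))
    simp only [zero_smul, add_zero] at this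
    refine this.trans_eq (lintegral_congr fun θ => ?_)
    rw [hg, indicator_of_mem (hball _ ?_)]
    simp
  have h2 : ∫⁻ v in ball (0 : Fin n → ℂ) r, ENNReal.ofReal (2 * Real.pi) * ‖f c‖ₑ ^ 2 ≤
      ∫⁻ v : Fin n → ℂ, ∫⁻ θ in Ioc 0 (2 * Real.pi), g (circleMap 0 1 θ • v) :=
    (setLIntegral_mono' measurableSet_ball hdisc).trans (setLIntegral_le_lintegral _ _)
  rw [lintegral_lintegral_swap hcm.aemeasurable] at h2
  have h3 : ∀ θ : ℝ, ∫⁻ v : Fin n → ℂ, g (circleMap 0 1 θ • v) = ∫⁻ v, g v := fun θ =>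
    (measurePreserving_smul_of_norm_eq_one (by simp)).lintegral_comp hgm
  simp only [h3, lintegral_const, Measure.restrict_apply MeasurableSet.univ, univ_inter,
    Real.volume_Ioc, sub_zero] at h2
  have h4 : ∫⁻ v, g v = ∫⁻ z in ball c r, ‖f z‖ₑ ^ 2 := by
    rw [← lintegral_indicator measurableSet_ball,
      ← lintegral_add_left_eq_self ((ball c r).indicator fun z => ‖f z‖ₑ ^ 2) c]
    congr 1
    ext v
    simp only [hg, indicator, mem_ball, dist_eq_norm, sub_zero, add_sub_cancel_left]
  rw [← h4]
  have hpi0 : ENNReal.ofReal (2 * Real.pi) ≠ 0 := by simp [Real.pi_pos]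
  rw [← ENNReal.mul_le_mul_iff_left hpi0 ENNReal.ofReal_ne_top]
  refine le_trans (le_of_eq ?_) h2
  ring

end MeanValue

/-! ### Holomorphic charts and their transition maps -/

section Transition

lemma mem_contDiffGroupoid_iff {n : ℕ} {e : OpenPartialHomeomorph (CSpace n) (CSpace n)} :
    e ∈ contDiffGroupoid ω 𝓘(ℂ, CSpace n) ↔
      ContDiffOn ℂ ω e e.source ∧ ContDiffOn ℂ ω e.symm e.target := by
  simp [contDiffGroupoid, mem_groupoid_of_pregroupoid, contDiffPregroupoid]

lemma isOpen_transition_source {H M : Type*} [TopologicalSpace H] [TopologicalSpace M]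
    (e₁ e₂ : OpenPartialHomeomorph M H) : IsOpen (e₂.target ∩ e₂.symm ⁻¹' e₁.source) :=
  e₂.isOpen_inter_preimage_symm e₁.open_source

variable {n : ℕ} {M : Type*} [TopologicalSpace M] [ChartedSpace (CSpace n) M]
  {e e₁ e₂ : OpenPartialHomeomorph M (CSpace n)}

lemma contDiffOn_transition (h₁ : e₁ ∈ holCharts (n := n) M) (h₂ : e₂ ∈ holCharts (n := n) M) :
    ContDiffOn ℂ ω (e₁ ∘ e₂.symm) (e₂.target ∩ e₂.symm ⁻¹' e₁.source) := by
  have := (mem_contDiffGroupoid_iff.1 (IsManifold.compatible_of_mem_maximalAtlas h₂ h₁)).1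
  simpa using this

lemma differentiableAt_transition (h₁ : e₁ ∈ holCharts (n := n) M)
    (h₂ : e₂ ∈ holCharts (n := n) M) {z : CSpace n}
    (hz : z ∈ e₂.target ∩ e₂.symm ⁻¹' e₁.source) : DifferentiableAt ℂ (e₁ ∘ e₂.symm) z :=
  ((contDiffOn_transition h₁ h₂).differentiableOn (by simp)).differentiableAt
    ((isOpen_transition_source e₁ e₂).mem_nhds hz)

lemma fderiv_transition_comp (h₁ : e₁ ∈ holCharts (n := n) M) (h₂ : e₂ ∈ holCharts (n := n) M)
    {x : M} (hx₁ : x ∈ e₁.source) (hx₂ : x ∈ e₂.source) :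
    (fderiv ℂ (e₂ ∘ e₁.symm) (e₁ x)).comp (fderiv ℂ (e₁ ∘ e₂.symm) (e₂ x)) =
      ContinuousLinearMap.id ℂ (CSpace n) := by
  have m₁ : e₁ x ∈ e₁.target ∩ e₁.symm ⁻¹' e₂.source := by simp [e₁.map_source hx₁, hx₁, hx₂]
  have m₂ : e₂ x ∈ e₂.target ∩ e₂.symm ⁻¹' e₁.source := by simp [e₂.map_source hx₂, hx₁, hx₂]
  have hd₁ := differentiableAt_transition h₂ h₁ m₁
  have hd₂ := differentiableAt_transition h₁ h₂ m₂
  have e : e₁ x = (e₁ ∘ e₂.symm) (e₂ x) := by simp [hx₂]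
  rw [e] at hd₁ ⊢
  rw [← fderiv_comp _ hd₁ hd₂, ← fderiv_id (𝕜 := ℂ) (x := e₂ x)]
  refine Filter.EventuallyEq.fderiv_eq ?_
  filter_upwards [(isOpen_transition_source e₁ e₂).mem_nhds m₂] with w hw
  simp [e₁.left_inv hw.2, e₂.right_inv hw.1]

lemma det_fderiv_transition_ne_zero (h₁ : e₁ ∈ holCharts (n := n) M)
    (h₂ : e₂ ∈ holCharts (n := n) M) {z : CSpace n}
    (hz : z ∈ e₂.target ∩ e₂.symm ⁻¹' e₁.source) : (fderiv ℂ (e₁ ∘ e₂.symm) z).det ≠ 0 := by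
  have := fderiv_transition_comp h₁ h₂ hz.2 (e₂.map_target hz.1)
  rw [e₂.right_inv hz.1] at this
  intro h0
  have h1 := congrArg ContinuousLinearMap.det this
  simp only [ContinuousLinearMap.det, ContinuousLinearMap.toLinearMap_comp,
    LinearMap.det_comp] at h1 h0
  rw [h0] at h1
  simp at h1

/-- The derivative of the inverse of a chart, with the tangent spaces of `M` identified with the
model space. -/
noncomputable def chartDeriv (e : OpenPartialHomeomorph M (CSpace n)) (z : CSpace n) :
    CSpace n →L[ℂ] CSpace n :=
  mfderiv 𝓘(ℂ, CSpace n) 𝓘(ℂ, CSpace n) e.symm z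

variable [IsManifold 𝓘(ℂ, CSpace n) ω M]

lemma chartAt_mem_holCharts (x : M) : chartAt (CSpace n) x ∈ holCharts (n := n) M :=
  IsManifold.chart_mem_maximalAtlas x

lemma mdifferentiable_of_mem_holCharts (h : e ∈ holCharts (n := n) M) :
    e.MDifferentiable 𝓘(ℂ, CSpace n) 𝓘(ℂ, CSpace n) := by
  have : IsManifold 𝓘(ℂ, CSpace n) 1 M := IsManifold.of_le (n := ω) le_top
  have h' := IsManifold.maximalAtlas_subset_of_le (I := 𝓘(ℂ, CSpace n)) (M := M)
    (le_top : (1 : WithTop ℕ∞) ≤ ω) h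
  exact ⟨fun x hx => (mdifferentiableAt_of_mem_maximalAtlas h' hx).mdifferentiableWithinAt,
    fun x hx => (mdifferentiableAt_symm_of_mem_maximalAtlas h' hx).mdifferentiableWithinAt⟩

lemma chartDeriv_eq_comp (h₁ : e₁ ∈ holCharts (n := n) M) (h₂ : e₂ ∈ holCharts (n := n) M)
    {z : CSpace n} (hz : z ∈ e₂.target ∩ e₂.symm ⁻¹' e₁.source) :
    chartDeriv e₂ z = (chartDeriv e₁ (e₁ (e₂.symm z))).comp (fderiv ℂ (e₁ ∘ e₂.symm) z) := by
  have hev : (e₂.symm : CSpace n → M) =ᶠ[𝓝 z] e₁.symm ∘ (e₁ ∘ e₂.symm) := by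
    filter_upwards [(isOpen_transition_source e₁ e₂).mem_nhds hz] with w hw
    simp [e₁.left_inv hw.2]
  have h : mfderiv 𝓘(ℂ, CSpace n) 𝓘(ℂ, CSpace n) e₂.symm z =
      mfderiv 𝓘(ℂ, CSpace n) 𝓘(ℂ, CSpace n) (e₁.symm ∘ (e₁ ∘ e₂.symm)) z := hev.mfderiv_eq
  rw [mfderiv_comp z ((mdifferentiable_of_mem_holCharts h₁).mdifferentiableAt_symm
      (e₁.map_source hz.2))
    (differentiableAt_transition h₁ h₂ hz).mdifferentiableAt, mfderiv_eq_fderiv] at h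
  exact h

lemma det_chartDeriv_ne_zero (h : e ∈ holCharts (n := n) M) {z : CSpace n} (hz : z ∈ e.target) :
    (chartDeriv e z).det ≠ 0 := by
  have hinj : Function.Injective (chartDeriv e z) :=
    (mdifferentiable_of_mem_holCharts h).symm.mfderiv_injective hz
  exact (LinearEquiv.ofInjectiveEndo (chartDeriv e z : CSpace n →ₗ[ℂ] CSpace n)
    hinj).isUnit_det'.ne_zero

end Transition

/-! ### Coefficients of `n`-forms -/

section Forms

variable {n : ℕ}

lemma alternating_apply_comp (g : (CSpace n) [⋀^Fin n]→L[ℂ] ℂ) (A B : CSpace n →L[ℂ] CSpace n) :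
    g (fun i => A (B (Pi.single i 1))) = B.det * g (fun i => A (Pi.single i 1)) := by
  set b := Pi.basisFun ℂ (Fin n)
  have h1 := (g.toAlternatingMap.compLinearMap (A : CSpace n →ₗ[ℂ] CSpace n)).eq_smul_basis_det b
  have h2 := b.det_comp (B : CSpace n →ₗ[ℂ] CSpace n) b
  have h3 := congrArg (fun q => q ((B : CSpace n →ₗ[ℂ] CSpace n) ∘ b)) h1
  simp only [AlternatingMap.smul_apply, h2, b.det_self] at h3
  have e : ∀ i, b i = Pi.single i 1 := fun i => Pi.basisFun_apply ℂ (Fin n) i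
  have e' : (fun i => A (Pi.single i 1)) = fun i => A (b i) := by simp only [e]
  have e'' : (fun i => A (B (Pi.single i 1))) = fun i => A (B (b i)) := by simp only [e]
  rw [e', e'']
  simpa [mul_comm, ContinuousLinearMap.det] using h3

lemma alternating_apply_eq_det (g : (CSpace n) [⋀^Fin n]→L[ℂ] ℂ) (v : Fin n → CSpace n) :
    g v = Matrix.det (Matrix.of v) * g (fun i => Pi.single i 1) := by
  set b := Pi.basisFun ℂ (Fin n) with hb
  have h1 := congrArg (fun q => q v) (g.toAlternatingMap.eq_smul_basis_det b)
  have e : (b : Fin n → CSpace n) = fun i => Pi.single i 1 := by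
    ext1 i; exact Pi.basisFun_apply ℂ (Fin n) i
  rw [e] at h1
  simp only [AlternatingMap.smul_apply, hb, Pi.basisFun_det_apply] at h1
  rw [mul_comm]
  exact h1

variable {M : Type*} [TopologicalSpace M] [ChartedSpace (CSpace n) M]

/-- The coefficient of an `n`-form with respect to the standard frame of the tangent space
`TangentSpace x = ℂⁿ`. -/
noncomputable def stdCoeff (f : TopForm (n := n) M) (x : M) : ℂ :=
  f x (fun i => (Pi.single i 1 : CSpace n))

lemma formCoeff_eq_det_mul (f : TopForm (n := n) M) (e : OpenPartialHomeomorph M (CSpace n))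
    (z : CSpace n) : formCoeff f e z = (chartDeriv e z).det * stdCoeff f (e.symm z) :=
  alternating_apply_comp (f (e.symm z)) (ContinuousLinearMap.id ℂ (CSpace n)) (chartDeriv e z)

lemma formCoeff_transition [IsManifold 𝓘(ℂ, CSpace n) ω M] (f : TopForm (n := n) M)
    {e₁ e₂ : OpenPartialHomeomorph M (CSpace n)} (h₁ : e₁ ∈ holCharts (n := n) M)
    (h₂ : e₂ ∈ holCharts (n := n) M) {z : CSpace n}
    (hz : z ∈ e₂.target ∩ e₂.symm ⁻¹' e₁.source) :
    formCoeff f e₂ z = (fderiv ℂ (e₁ ∘ e₂.symm) z).det * formCoeff f e₁ (e₁ (e₂.symm z)) := by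
  rw [formCoeff_eq_det_mul, formCoeff_eq_det_mul, e₁.left_inv hz.2, chartDeriv_eq_comp h₁ h₂ hz]
  simp only [ContinuousLinearMap.det, ContinuousLinearMap.toLinearMap_comp, LinearMap.det_comp]
  ring

lemma formCoeff_sum {ι : Type*} (φ : ι → TopForm (n := n) M) (s : Finset ι) (a : ι → ℂ)
    (e : OpenPartialHomeomorph M (CSpace n)) (z : CSpace n) :
    formCoeff (fun x => ∑ j ∈ s, a j • φ j x) e z = ∑ j ∈ s, a j * formCoeff (φ j) e z := by
  simp [formCoeff, ContinuousAlternatingMap.sum_apply]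

end Forms

/-! ### Local bounds for the Bergman kernel -/

section LocalBound

variable {n : ℕ} {M : Type*} [TopologicalSpace M] [ChartedSpace (CSpace n) M]

lemma abs_det_restrictScalars (A : CSpace n →L[ℂ] CSpace n) :
    ENNReal.ofReal |(A.restrictScalars ℝ).det| = ‖A.det‖ₑ ^ 2 := by
  have h : (A.restrictScalars ℝ).det = Complex.normSq A.det := by
    rw [← Algebra.norm_complex_apply]
    exact LinearMap.det_restrictScalars (R := ℝ) (S := ℂ) (f := (A : CSpace n →ₗ[ℂ] CSpace n))
  rw [h, abs_of_nonneg (Complex.normSq_nonneg _), Complex.normSq_eq_norm_sq,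
    ENNReal.ofReal_pow (norm_nonneg _), ofReal_norm]

variable [SecondCountableTopology M] [Nonempty M]

lemma coverChart_source_cover (n : ℕ) (M : Type*) [TopologicalSpace M] [ChartedSpace (CSpace n) M]
    [SecondCountableTopology M] [Nonempty M] : ⋃ k, (coverChart n M k).source = univ :=
  (exists_chart_cover n M).choose_spec

lemma measurableSet_inter_preimage_disjointed (e : OpenPartialHomeomorph M (CSpace n)) (k : ℕ) :
    MeasurableSet
      (e.target ∩ e.symm ⁻¹' disjointed (fun j => (coverChart n M j).source) k) := by
  have h : e.target ∩ e.symm ⁻¹' disjointed (fun j => (coverChart n M j).source) k =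
      (e.target ∩ e.symm ⁻¹' (coverChart n M k).source) \
        ⋃ j ∈ Finset.range k, (e.target ∩ e.symm ⁻¹' (coverChart n M j).source) := by
    rw [disjointed_eq_inter_compl]
    ext z
    simp only [mem_inter_iff, mem_preimage, mem_iInter, mem_compl_iff, Set.mem_sdiff, mem_iUnion,
      Finset.mem_range, exists_prop, not_exists, not_and]
    constructor
    · rintro ⟨h1, h2, h3⟩
      exact ⟨⟨h1, h2⟩, fun j hj _ => h3 j hj⟩
    · rintro ⟨⟨h1, h2⟩, h3⟩
      exact ⟨h1, h2, fun j hj => h3 j hj h1⟩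
  rw [h]
  refine (isOpen_transition_source _ _).measurableSet.diff ?_
  exact Finset.measurableSet_biUnion _ fun j _ => (isOpen_transition_source _ _).measurableSet

lemma measurableSet_coverPiece (k : ℕ) : MeasurableSet (coverPiece n M k) :=
  measurableSet_inter_preimage_disjointed _ k

/-- The square of the norm of an `n`-form, as an extended real number, up to the factor `2 ^ n`. -/
noncomputable def formEnergy (f : TopForm (n := n) M) : ℝ≥0∞ :=
  ∑' k, ∫⁻ z in coverPiece n M k, ‖formCoeff f (coverChart n M k) z‖ₑ ^ 2

/-- In any holomorphic chart, the square integral of the coefficient of an `n`-form over a part of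
the chart is at most the square norm of the form: each piece of the chart is moved to the
corresponding chart of the cover by the transition map, whose real Jacobian is the square of the
absolute value of the complex one. -/
lemma setLIntegral_formCoeff_le [IsManifold 𝓘(ℂ, CSpace n) ω M] (f : TopForm (n := n) M)
    {e : OpenPartialHomeomorph M (CSpace n)} (he : e ∈ holCharts (n := n) M)
    {B : Set (CSpace n)} (hB : MeasurableSet B) (hBe : B ⊆ e.target) :
    ∫⁻ z in B, ‖formCoeff f e z‖ₑ ^ 2 ≤ formEnergy f := by
  set S : ℕ → Set (CSpace n) := fun k =>
    B ∩ e.symm ⁻¹' disjointed (fun j => (coverChart n M j).source) k with hS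
  have hSB : ⋃ k, S k = B := by
    simp only [hS]
    rw [← inter_iUnion, ← preimage_iUnion, iUnion_disjointed, coverChart_source_cover]
    simp
  have hSm : ∀ k, MeasurableSet (S k) := fun k => by
    have := hB.inter (measurableSet_inter_preimage_disjointed e k)
    rwa [← inter_assoc, inter_eq_self_of_subset_left hBe] at this
  conv_lhs => rw [← hSB]
  refine (lintegral_iUnion_le _ _).trans (ENNReal.tsum_le_tsum fun k => ?_)
  set c := coverChart n M k with hc
  have hcM : c ∈ holCharts (n := n) M := chartAt_mem_holCharts _
  have hsub : ∀ z ∈ S k, z ∈ e.target ∩ e.symm ⁻¹' c.source := fun z hz =>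
    ⟨hBe hz.1, disjointed_le (fun j => (coverChart n M j).source) k hz.2⟩
  have hder : ∀ z ∈ S k, HasFDerivWithinAt (c ∘ e.symm)
      ((fderiv ℂ (c ∘ e.symm) z).restrictScalars ℝ) (S k) z := fun z hz =>
    ((differentiableAt_transition hcM he (hsub z hz)).hasFDerivAt.restrictScalars
      ℝ).hasFDerivWithinAt
  have hinj : InjOn (c ∘ e.symm) (S k) := fun z hz w hw h =>
    e.symm.injOn (hsub z hz).1 (hsub w hw).1 (c.injOn (hsub z hz).2 (hsub w hw).2 h)
  have hcv := lintegral_image_eq_lintegral_abs_det_fderiv_mul volume (hSm k) hder hinj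
    fun z => ‖formCoeff f c z‖ₑ ^ 2
  have himg : (c ∘ e.symm) '' S k ⊆ coverPiece n M k := by
    rintro _ ⟨z, hz, rfl⟩
    refine ⟨c.map_source (hsub z hz).2, ?_⟩
    have h := hz.2
    rw [mem_preimage, ← c.left_inv (hsub z hz).2] at h
    exact h
  calc ∫⁻ z in S k, ‖formCoeff f e z‖ₑ ^ 2
      = ∫⁻ z in S k, ENNReal.ofReal |((fderiv ℂ (c ∘ e.symm) z).restrictScalars ℝ).det| *
          ‖formCoeff f c ((c ∘ e.symm) z)‖ₑ ^ 2 := by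
        refine setLIntegral_congr_fun (hSm k) fun z hz => ?_
        rw [abs_det_restrictScalars, formCoeff_transition f hcM he (hsub z hz), enorm_mul, mul_pow]
        rfl
    _ = ∫⁻ z in (c ∘ e.symm) '' S k, ‖formCoeff f c z‖ₑ ^ 2 := hcv.symm
    _ ≤ _ := lintegral_mono_set himg

lemma memLp_formCoeff [IsManifold 𝓘(ℂ, CSpace n) ω M] {f : TopForm (n := n) M}
    (hf : f ∈ bergmanSpace n M) (k : ℕ) :
    MemLp (formCoeff f (coverChart n M k)) 2 (volume.restrict (coverPiece n M k)) := by
  have hcont : ContinuousOn (formCoeff f (coverChart n M k)) (coverPiece n M k) :=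
    ((hf.1 _ (chartAt_mem_holCharts _)).continuousOn).mono inter_subset_left
  refine ⟨hcont.aestronglyMeasurable (measurableSet_coverPiece k), ?_⟩
  rw [eLpNorm_lt_top_iff_lintegral_rpow_enorm_lt_top (by simp) (by simp)]
  simp only [ENNReal.toReal_ofNat, ENNReal.rpow_ofNat]
  exact (ENNReal.le_tsum k).trans_lt hf.2

/-- The contribution of the `k`-th piece of the manifold to the hermitian product of two forms. -/
noncomputable def pieceInner (f g : TopForm (n := n) M) (k : ℕ) : ℂ :=
  ∫ z in coverPiece n M k,
    formCoeff f (coverChart n M k) z * conj (formCoeff g (coverChart n M k) z)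

lemma integrable_formCoeff_mul [IsManifold 𝓘(ℂ, CSpace n) ω M] {f g : TopForm (n := n) M}
    (hf : f ∈ bergmanSpace n M) (hg : g ∈ bergmanSpace n M) (k : ℕ) :
    Integrable (fun z => formCoeff f (coverChart n M k) z *
      conj (formCoeff g (coverChart n M k) z)) (volume.restrict (coverPiece n M k)) :=
  (memLp_formCoeff hf k).integrable_mul (memLp_formCoeff hg k).star

lemma enorm_pieceInner_le [IsManifold 𝓘(ℂ, CSpace n) ω M] {f g : TopForm (n := n) M}
    (hf : f ∈ bergmanSpace n M) (k : ℕ) :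
    ‖pieceInner f g k‖ₑ ≤ (∫⁻ z in coverPiece n M k, ‖formCoeff f (coverChart n M k) z‖ₑ ^ 2) +
      ∫⁻ z in coverPiece n M k, ‖formCoeff g (coverChart n M k) z‖ₑ ^ 2 := by
  rw [← lintegral_add_left' ((memLp_formCoeff hf k).1.enorm.pow_const 2)]
  refine (enorm_integral_le_lintegral_enorm _).trans (lintegral_mono fun z => ?_)
  rw [enorm_mul, RCLike.enorm_conj, sq, sq]
  rcases le_total ‖formCoeff f (coverChart n M k) z‖ₑ ‖formCoeff g (coverChart n M k) z‖ₑ with h | h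
  · exact (mul_le_mul_left h _).trans le_add_self
  · exact (mul_le_mul_right h _).trans le_self_add

lemma summable_pieceInner [IsManifold 𝓘(ℂ, CSpace n) ω M] {f g : TopForm (n := n) M}
    (hf : f ∈ bergmanSpace n M) (hg : g ∈ bergmanSpace n M) : Summable (pieceInner f g) := by
  have h : ∑' k, ‖pieceInner f g k‖ₑ ≠ ⊤ := by
    refine ((ENNReal.tsum_le_tsum fun k => enorm_pieceInner_le (g := g) hf k).trans_lt ?_).ne
    rw [ENNReal.tsum_add]
    exact ENNReal.add_lt_top.2 ⟨hf.2, hg.2⟩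
  have h2 := ENNReal.summable_toReal h
  simp only [toReal_enorm] at h2
  exact h2.of_norm

variable {ι : Type*} {φ : ι → TopForm (n := n) M}

/-- Pythagoras' theorem for finite linear combinations of orthonormal forms. -/
lemma formEnergy_sum_eq [IsManifold 𝓘(ℂ, CSpace n) ω M] (hφ : IsBergmanBasis φ) (s : Finset ι)
    (a : ι → ℂ) :
    formEnergy (fun x => ∑ j ∈ s, a j • φ j x) = ENNReal.ofReal ((∑ j ∈ s, ‖a j‖ ^ 2) / 2 ^ n) := by
  classical
  set f : TopForm (n := n) M := fun x => ∑ j ∈ s, a j • φ j x with hf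
  have hfk : ∀ k z, formCoeff f (coverChart n M k) z =
      ∑ j ∈ s, a j * formCoeff (φ j) (coverChart n M k) z := fun k z => formCoeff_sum φ s a _ z
  have hmem : ∀ k, MemLp (formCoeff f (coverChart n M k)) 2
      (volume.restrict (coverPiece n M k)) := fun k => by
    have h1 := memLp_finsetSum s fun j (_ : j ∈ s) => (memLp_formCoeff (hφ.mem j) k).const_mul (a j)
    exact (memLp_congr_ae (Eventually.of_forall fun z => hfk k z)).2 h1
  set I : ℕ → ℝ := fun k => ∫ z in coverPiece n M k, ‖formCoeff f (coverChart n M k) z‖ ^ 2 with hI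
  have hI0 : ∀ k, 0 ≤ I k := fun k => integral_nonneg fun z => by positivity
  have hlin : ∀ k, ∫⁻ z in coverPiece n M k, ‖formCoeff f (coverChart n M k) z‖ₑ ^ 2 =
      ENNReal.ofReal (I k) := fun k => by
    have hint : Integrable (fun z => ‖formCoeff f (coverChart n M k) z‖ ^ 2)
        (volume.restrict (coverPiece n M k)) := (hmem k).norm.integrable_sq
    simp only [hI]
    rw [ofReal_integral_eq_lintegral_ofReal hint
      (Eventually.of_forall fun z => by positivity)]
    refine lintegral_congr fun z => ?_
    rw [ENNReal.ofReal_pow (norm_nonneg _), ofReal_norm]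
  have hIC : ∀ k, (I k : ℂ) = ∑ j ∈ s, ∑ l ∈ s, a j * conj (a l) * pieceInner (φ j) (φ l) k := by
    intro k
    rw [hI, ← integral_complex_ofReal]
    have : ∀ z, ((‖formCoeff f (coverChart n M k) z‖ ^ 2 : ℝ) : ℂ) =
        ∑ j ∈ s, ∑ l ∈ s, a j * conj (a l) * (formCoeff (φ j) (coverChart n M k) z *
          conj (formCoeff (φ l) (coverChart n M k) z)) := by
      intro z
      rw [Complex.ofReal_pow, ← Complex.mul_conj', hfk, map_sum, Finset.sum_mul_sum]
      refine Finset.sum_congr rfl fun j _ => Finset.sum_congr rfl fun l _ => ?_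
      rw [map_mul]; ring
    simp only [this]
    have hint : ∀ j l, Integrable (fun z => a j * conj (a l) *
        (formCoeff (φ j) (coverChart n M k) z * conj (formCoeff (φ l) (coverChart n M k) z)))
        (volume.restrict (coverPiece n M k)) := fun j l =>
      (integrable_formCoeff_mul (hφ.mem j) (hφ.mem l) k).const_mul _
    rw [integral_finsetSum _ fun j _ => integrable_finsetSum _ fun l _ => hint j l]
    refine Finset.sum_congr rfl fun j _ => ?_
    rw [integral_finsetSum _ fun l _ => hint j l]
    exact Finset.sum_congr rfl fun l _ => integral_const_mul _ _
  have hpair : ∀ j l, HasSum (pieceInner (φ j) (φ l)) (if j = l then 1 / 2 ^ n else 0) := by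
    intro j l
    have h1 := (summable_pieceInner (hφ.mem j) (hφ.mem l)).hasSum
    have h2 : formInner (φ j) (φ l) = 2 ^ n * ∑' k, pieceInner (φ j) (φ l) k := rfl
    convert h1
    have h3 : (2 : ℂ) ^ n ≠ 0 := pow_ne_zero _ two_ne_zero
    split_ifs with h
    · subst h
      rw [hφ.norm_one] at h2
      rw [h2]; field_simp
    · rw [hφ.orthogonal j l h] at h2
      exact ((mul_eq_zero.1 h2.symm).resolve_left h3).symm
  have hsumC : HasSum (fun k => (I k : ℂ)) (((∑ j ∈ s, ‖a j‖ ^ 2) / 2 ^ n : ℝ) : ℂ) := by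
    simp only [hIC]
    have := hasSum_sum (s := s) fun j _ => hasSum_sum (s := s) fun l _ =>
      (hpair j l).mul_left (a j * conj (a l))
    suffices h : (((∑ j ∈ s, ‖a j‖ ^ 2) / 2 ^ n : ℝ) : ℂ) =
        ∑ j ∈ s, ∑ l ∈ s, a j * conj (a l) * (if j = l then 1 / 2 ^ n else 0) by
      rw [h]; exact this
    push_cast
    rw [Finset.sum_div]
    refine Finset.sum_congr rfl fun j hj => ?_
    simp only [mul_ite, mul_zero, Finset.sum_ite_eq, hj, if_true]
    rw [Complex.mul_conj']; ring
  have hsum : HasSum I ((∑ j ∈ s, ‖a j‖ ^ 2) / 2 ^ n) := by exact_mod_cast hsumC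
  rw [formEnergy]
  simp only [hlin]
  rw [← ENNReal.ofReal_tsum_of_nonneg hI0 hsum.summable, hsum.tsum_eq]

/-- Bessel's inequality for the evaluation functionals: the squares of the coefficients of an
orthonormal system of forms are summable at each point, with locally bounded sums. -/
lemma exists_ball_sum_norm_sq_le [IsManifold 𝓘(ℂ, CSpace n) ω M] (hφ : IsBergmanBasis φ)
    {e : OpenPartialHomeomorph M (CSpace n)} (he : e ∈ holCharts (n := n) M) {c : CSpace n}
    (hc : c ∈ e.target) :
    ∃ R > 0, ∃ C, ball c R ⊆ e.target ∧
      ∀ z ∈ ball c R, ∀ s : Finset ι, ∑ j ∈ s, ‖formCoeff (φ j) e z‖ ^ 2 ≤ C := by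
  obtain ⟨R, hR, hRe⟩ := Metric.isOpen_iff.1 e.open_target c hc
  have hR2 : 0 < R / 2 := by positivity
  set V : ℝ := (volume (ball (0 : CSpace n) (R / 2))).toReal with hV
  have hVtop : volume (ball (0 : CSpace n) (R / 2)) ≠ ⊤ := measure_ball_lt_top.ne
  have hV0 : 0 < V := ENNReal.toReal_pos (measure_ball_pos _ _ hR2).ne' hVtop
  refine ⟨R / 2, hR2, 1 / (V * 2 ^ n), (ball_subset_ball (by linarith)).trans hRe,
    fun z hz s => ?_⟩
  have hzR : ball z (R / 2) ⊆ e.target := fun w hw => hRe <| by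
    rw [mem_ball] at *; linarith [dist_triangle w z c]
  -- the form that represents the evaluation at `z` on the span of the forms `φ j`, `j ∈ s`
  set f : TopForm (n := n) M := fun x => ∑ j ∈ s, conj (formCoeff (φ j) e z) • φ j x with hf
  set S : ℝ := ∑ j ∈ s, ‖formCoeff (φ j) e z‖ ^ 2 with hS
  have hS0 : 0 ≤ S := Finset.sum_nonneg fun j _ => by positivity
  have hfz : formCoeff f e z = S := by
    rw [hf, formCoeff_sum, hS]
    push_cast
    exact Finset.sum_congr rfl fun j _ => Complex.conj_mul' _
  have hdiff : DifferentiableOn ℂ (formCoeff f e) (ball z (R / 2)) := by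
    have : formCoeff f e = fun w => ∑ j ∈ s, conj (formCoeff (φ j) e z) * formCoeff (φ j) e w := by
      ext w; exact formCoeff_sum φ s _ e w
    rw [this]
    exact DifferentiableOn.fun_sum fun j _ => (((hφ.mem j).1 e he).mono hzR).const_mul _
  have h1 := (volume_ball_mul_enorm_sq_le hdiff).trans
    (setLIntegral_formCoeff_le f he measurableSet_ball hzR)
  rw [hf, formEnergy_sum_eq hφ, ← hf, hfz] at h1
  simp only [RCLike.norm_conj] at h1
  rw [← hS, ← ofReal_norm, Complex.norm_real, Real.norm_of_nonneg hS0,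
    ← ENNReal.ofReal_pow hS0, ← ENNReal.ofReal_toReal hVtop, ← hV, ← ENNReal.ofReal_mul hV0.le,
    ENNReal.ofReal_le_ofReal_iff (by positivity)] at h1
  rcases hS0.eq_or_lt with h | h
  · rw [← h]; positivity
  · rw [le_div_iff₀ (by positivity)]
    rw [le_div_iff₀ (by positivity)] at h1
    refine le_of_mul_le_mul_left ?_ h
    calc S * (S * (V * 2 ^ n)) = V * S ^ 2 * 2 ^ n := by ring
      _ ≤ S * 1 := by linarith

/-- The `ℓ²`-valued holomorphic map whose entries are the coefficients of the forms `φ j`. -/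
noncomputable def coeffVector (φ : ι → TopForm (n := n) M)
    (e : OpenPartialHomeomorph M (CSpace n)) (z : CSpace n) : lp (fun _ : ι => ℂ) 2 :=
  toL2 fun j => formCoeff (φ j) e z

lemma differentiableOn_coeffVector [IsManifold 𝓘(ℂ, CSpace n) ω M] (hφ : IsBergmanBasis φ)
    {e : OpenPartialHomeomorph M (CSpace n)} (he : e ∈ holCharts (n := n) M) :
    DifferentiableOn ℂ (coeffVector φ e) e.target :=
  differentiableOn_toL2 (fun j => (hφ.mem j).1 e he) fun _ hc => exists_ball_sum_norm_sq_le hφ he hc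

lemma kernelFun_eq_inner [IsManifold 𝓘(ℂ, CSpace n) ω M] (hφ : IsBergmanBasis φ)
    {e e' : OpenPartialHomeomorph M (CSpace n)} (he : e ∈ holCharts (n := n) M)
    (he' : e' ∈ holCharts (n := n) M) {z w : CSpace n} (hz : z ∈ e.target) (hw : w ∈ e'.target) :
    kernelFun φ e e' z w = inner ℂ (coeffVector φ e' w) (coeffVector φ e z) := by
  have hm : ∀ {e : OpenPartialHomeomorph M (CSpace n)}, e ∈ holCharts (n := n) M →
      ∀ {z}, z ∈ e.target → Memℓp (fun j => formCoeff (φ j) e z) 2 := fun he _ hz => by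
    obtain ⟨R, hR, C, -, hC⟩ := exists_ball_sum_norm_sq_le hφ he hz
    exact memℓp_two_of_sum_le (hC _ (mem_ball_self hR))
  rw [lp.inner_eq_tsum]
  refine tsum_congr fun j => ?_
  rw [coeffVector, coeffVector, toL2_apply (hm he hz), toL2_apply (hm he' hw)]
  rfl

end LocalBound

/-! ### The developing map -/

section Wirtinger

variable {n : ℕ}

lemma dbar_const_mul (k : Fin n) (c : ℂ) (F : CSpace n → ℂ) (w : CSpace n) :
    dbar k (fun w' => c * F w') w = c * dbar k F w := by
  simp only [dbar, lineDeriv, deriv_const_mul_field]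
  ring

lemma dbar_congr {k : Fin n} {F G : CSpace n → ℂ} {w : CSpace n} (h : F =ᶠ[𝓝 w] G) :
    dbar k F w = dbar k G w := by
  simp only [dbar, h.lineDeriv_eq]

lemma dbar_inner {H : Type*} [NormedAddCommGroup H] [InnerProductSpace ℂ H] (k : Fin n)
    {G : CSpace n → H} {w : CSpace n} (hG : DifferentiableAt ℂ G w) (v : H) :
    dbar k (fun w' => inner ℂ (G w') v) w = inner ℂ (fderiv ℂ G w (Pi.single k 1)) v := by
  have hl : ∀ u, lineDeriv ℝ (fun w' => inner ℂ (G w') v) w u = inner ℂ (fderiv ℂ G w u) v := by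
    intro u
    have h1 := (hG.hasFDerivAt.restrictScalars ℝ).hasLineDerivAt u
    exact HasDerivAt.deriv (by simpa using HasDerivAt.inner ℂ h1 (hasDerivAt_const (0 : ℝ) v))
  have hI : (Pi.single k Complex.I : CSpace n) = Complex.I • Pi.single k 1 := by
    rw [← Pi.single_smul]; simp
  rw [dbar, hl, hl, hI, map_smul, inner_smul_left, Complex.conj_I, ← mul_assoc]
  simp

end Wirtinger

section RepMap

variable {n : ℕ} {M : Type*} [TopologicalSpace M] [ChartedSpace (CSpace n) M]
  {ι : Type*} {φ : ι → TopForm (n := n) M}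

/-- The vector `(∂/∂w̄_1|_{w=p} log K*(x, w̄), …, ∂/∂w̄_n|_{w=p} log K*(x, w̄))`, as a function of
the point `x`, for the coordinate system `e'` at `p`. It is the developing map of the Bochner
connection. -/
noncomputable def repMap (φ : ι → TopForm (n := n) M) (p : M)
    (e' : OpenPartialHomeomorph M (CSpace n)) (x : M) : CSpace n :=
  fun k => dbarLogKernel φ (chartAt (CSpace n) x) e' k (chartAt (CSpace n) x x) (e' p)

lemma bergmanRep_eq (p : M) (e' : OpenPartialHomeomorph M (CSpace n)) (x : M) :
    bergmanRep φ p e' x = fun j => ∑ k, (metricMatrix φ e' e' (e' p) (e' p))⁻¹ k j *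
      (repMap φ p e' x k - dbarLogKernel φ e' e' k (e' p) (e' p)) := rfl

lemma bergmanKernel_eq (x y : M) (v u : Fin n → CSpace n) :
    bergmanKernel φ x y v u = (Matrix.of v).det * conj (Matrix.of u).det *
      ∑' j, stdCoeff (φ j) x * conj (stdCoeff (φ j) y) := by
  rw [← tsum_mul_left]
  refine tsum_congr fun j => ?_
  have h1 : φ j x v = _ := alternating_apply_eq_det (φ j x) v
  have h2 : φ j y u = _ := alternating_apply_eq_det (φ j y) u
  rw [h1, h2, map_mul]
  exact mul_mul_mul_comm _ _ _ _

lemma mem_zeroSet_iff_tsum {x p : M} :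
    x ∈ zeroSet φ p ↔ ∑' j, stdCoeff (φ j) x * conj (stdCoeff (φ j) p) = 0 := by
  constructor
  · intro h
    have h1 : bergmanKernel φ x p = 0 := h
    have h2 := bergmanKernel_eq (φ := φ) x p (fun i => Pi.single i 1) (fun i => Pi.single i 1)
    replace h2 : (0 : ℂ) = _ := (congrFun (congrFun h1 _) _).symm.trans h2
    have h3 : Matrix.of (fun i : Fin n => (Pi.single i 1 : Fin n → ℂ)) = 1 := by
      ext i j; simp [Matrix.one_apply, Pi.single_apply, eq_comm]
    rw [h3] at h2
    simpa using h2.symm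
  · intro h
    change bergmanKernel φ x p = 0
    funext v u
    have := bergmanKernel_eq (φ := φ) x p v u
    rw [h, mul_zero] at this
    exact this

variable [IsManifold 𝓘(ℂ, CSpace n) ω M] {e e₁ e₂ e' : OpenPartialHomeomorph M (CSpace n)}

lemma mem_zeroSet_iff_kernelFun {x p : M} (he : e ∈ holCharts (n := n) M) (hx : x ∈ e.source)
    (he' : e' ∈ holCharts (n := n) M) (hp : p ∈ e'.source) :
    x ∈ zeroSet φ p ↔ kernelFun φ e e' (e x) (e' p) = 0 := by
  have h : kernelFun φ e e' (e x) (e' p) = (chartDeriv e (e x)).det *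
      conj (chartDeriv e' (e' p)).det * ∑' j, stdCoeff (φ j) x * conj (stdCoeff (φ j) p) := by
    rw [← tsum_mul_left]
    refine tsum_congr fun j => ?_
    change formCoeff (φ j) e (e x) * conj (formCoeff (φ j) e' (e' p)) = _
    rw [formCoeff_eq_det_mul, formCoeff_eq_det_mul, e.left_inv hx, e'.left_inv hp, map_mul]
    ring
  have h1 := det_chartDeriv_ne_zero he (e.map_source hx)
  have h2 := (map_ne_zero (starRingEnd ℂ)).2 (det_chartDeriv_ne_zero he' (e'.map_source hp))
  rw [h, mem_zeroSet_iff_tsum, mul_eq_zero, or_iff_right (mul_ne_zero h1 h2)]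

lemma kernelFun_transition (h₁ : e₁ ∈ holCharts (n := n) M) (h₂ : e₂ ∈ holCharts (n := n) M)
    {z : CSpace n} (hz : z ∈ e₂.target ∩ e₂.symm ⁻¹' e₁.source) (w : CSpace n) :
    kernelFun φ e₂ e' z w =
      (fderiv ℂ (e₁ ∘ e₂.symm) z).det * kernelFun φ e₁ e' (e₁ (e₂.symm z)) w := by
  change ∑' j, formCoeff (φ j) e₂ z * _ = _ * ∑' j, formCoeff (φ j) e₁ (e₁ (e₂.symm z)) * _
  rw [← tsum_mul_left]
  refine tsum_congr fun j => ?_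
  rw [formCoeff_transition (φ j) h₁ h₂ hz]
  ring

lemma dbarLogKernel_transition (h₁ : e₁ ∈ holCharts (n := n) M) (h₂ : e₂ ∈ holCharts (n := n) M)
    {z : CSpace n} (hz : z ∈ e₂.target ∩ e₂.symm ⁻¹' e₁.source) (k : Fin n) (w : CSpace n) :
    dbarLogKernel φ e₂ e' k z w = dbarLogKernel φ e₁ e' k (e₁ (e₂.symm z)) w := by
  have h0 := det_fderiv_transition_ne_zero h₁ h₂ hz
  simp only [dbarLogKernel, kernelFun_transition h₁ h₂ hz, dbar_const_mul]
  rw [mul_div_mul_left _ _ h0]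

lemma dbarLogKernel_eq_repMap (he : e ∈ holCharts (n := n) M) (p : M) {z : CSpace n}
    (hz : z ∈ e.target) (k : Fin n) :
    dbarLogKernel φ e e' k z (e' p) = repMap φ p e' (e.symm z) k :=
  dbarLogKernel_transition (chartAt_mem_holCharts _) he ⟨hz, mem_chart_source _ _⟩ k _

variable [SecondCountableTopology M] [Nonempty M]

lemma differentiableOn_kernelFun (hφ : IsBergmanBasis φ) (he : e ∈ holCharts (n := n) M)
    (he' : e' ∈ holCharts (n := n) M) {w : CSpace n} (hw : w ∈ e'.target) :
    DifferentiableOn ℂ (fun z => kernelFun φ e e' z w) e.target :=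
  ((innerSL ℂ (coeffVector φ e' w)).differentiable.comp_differentiableOn
    (differentiableOn_coeffVector hφ he)).congr fun z hz => by
      simp [kernelFun_eq_inner hφ he he' hz hw]

lemma dbar_kernelFun (hφ : IsBergmanBasis φ) (he : e ∈ holCharts (n := n) M)
    (he' : e' ∈ holCharts (n := n) M) {z w : CSpace n} (hz : z ∈ e.target) (hw : w ∈ e'.target)
    (k : Fin n) :
    dbar k (fun w' => kernelFun φ e e' z w') w =
      inner ℂ (fderiv ℂ (coeffVector φ e') w (Pi.single k 1)) (coeffVector φ e z) := by
  rw [← dbar_inner k ((differentiableOn_coeffVector hφ he').differentiableAt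
    (e'.open_target.mem_nhds hw))]
  refine dbar_congr ?_
  filter_upwards [e'.open_target.mem_nhds hw] with w' hw'
  exact kernelFun_eq_inner hφ he he' hz hw'

lemma differentiableOn_dbar_kernelFun (hφ : IsBergmanBasis φ) (he : e ∈ holCharts (n := n) M)
    (he' : e' ∈ holCharts (n := n) M) {w : CSpace n} (hw : w ∈ e'.target) (k : Fin n) :
    DifferentiableOn ℂ (fun z => dbar k (fun w' => kernelFun φ e e' z w') w) e.target :=
  ((innerSL ℂ (fderiv ℂ (coeffVector φ e') w (Pi.single k 1))).differentiable.comp_differentiableOn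
    (differentiableOn_coeffVector hφ he)).congr fun z hz => by
      simp [dbar_kernelFun hφ he he' hz hw]

/-- The part of the chart `e` off the zeros of `K(·, p̄)` is open. -/
lemma isOpen_inter_preimage_compl_zeroSet (hφ : IsBergmanBasis φ) (he : e ∈ holCharts (n := n) M)
    (p : M) : IsOpen (e.target ∩ e.symm ⁻¹' (zeroSet φ p)ᶜ) := by
  have h1 := chartAt_mem_holCharts (n := n) p
  have hp := mem_chart_source (CSpace n) p
  have h := (differentiableOn_kernelFun hφ he h1 ((chartAt (CSpace n) p).map_source
    hp)).continuousOn.isOpen_inter_preimage e.open_target (isOpen_compl_singleton (x := (0 : ℂ)))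
  convert h using 1
  ext z
  simp only [mem_inter_iff, mem_preimage, mem_compl_iff, mem_singleton_iff, and_congr_right_iff]
  intro hz
  rw [mem_zeroSet_iff_kernelFun he (e.map_target hz) h1 hp, e.right_inv hz]

lemma differentiableOn_repMap (hφ : IsBergmanBasis φ) (he : e ∈ holCharts (n := n) M)
    (he' : e' ∈ holCharts (n := n) M) {p : M} (hp : p ∈ e'.source) :
    DifferentiableOn ℂ (repMap φ p e' ∘ e.symm) (e.target ∩ e.symm ⁻¹' (zeroSet φ p)ᶜ) := by
  rw [differentiableOn_pi]
  intro k
  have hw := e'.map_source hp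
  have h : DifferentiableOn ℂ (fun z => dbarLogKernel φ e e' k z (e' p))
      (e.target ∩ e.symm ⁻¹' (zeroSet φ p)ᶜ) := by
    have h1 := (differentiableOn_dbar_kernelFun hφ he he' hw k).mono
      (inter_subset_left (t := e.symm ⁻¹' (zeroSet φ p)ᶜ))
    have h2 := (differentiableOn_kernelFun hφ he he' hw).mono
      (inter_subset_left (t := e.symm ⁻¹' (zeroSet φ p)ᶜ))
    simp only [dbarLogKernel, div_eq_mul_inv]
    refine h1.fun_mul (h2.fun_inv fun z hz => ?_)
    have := hz.2
    rwa [mem_preimage, mem_compl_iff, mem_zeroSet_iff_kernelFun he (e.map_target hz.1) he' hp,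
      e.right_inv hz.1] at this
  exact h.congr fun z hz => (dbarLogKernel_eq_repMap he p hz.1 k).symm

/-- The matrix with rows `∂F/∂z_1, …, ∂F/∂z_n`. -/
noncomputable def jacobian (F : CSpace n → CSpace n) (z : CSpace n) : Matrix (Fin n) (Fin n) ℂ :=
  Matrix.of fun j k => fderiv ℂ F z (Pi.single j 1) k

lemma metricMatrix_eq_jacobian (hφ : IsBergmanBasis φ) (he : e ∈ holCharts (n := n) M)
    (he' : e' ∈ holCharts (n := n) M) {p : M} (hp : p ∈ e'.source) {z : CSpace n}
    (hz : z ∈ e.target ∩ e.symm ⁻¹' (zeroSet φ p)ᶜ) :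
    metricMatrix φ e e' z (e' p) = jacobian (repMap φ p e' ∘ e.symm) z := by
  have hd := (differentiableOn_repMap hφ he he' hp).differentiableAt
    ((isOpen_inter_preimage_compl_zeroSet hφ he p).mem_nhds hz)
  ext j k
  simp only [metricMatrix, jacobian, Matrix.of_apply, dz]
  have hev : (fun z' => dbarLogKernel φ e e' k z' (e' p)) =ᶠ[𝓝 z]
      fun z' => (repMap φ p e' ∘ e.symm) z' k := by
    filter_upwards [e.open_target.mem_nhds hz.1] with z' hz'
    exact dbarLogKernel_eq_repMap he p hz' k
  rw [hev.lineDeriv_eq, (differentiableAt_pi.1 hd k).lineDeriv_eq_fderiv, fderiv_apply hd]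
  rfl

end RepMap

/-! ### The set `M^p` and its developing map -/

section Jacobian

variable {n : ℕ}

lemma vecMul_jacobian (F : CSpace n → CSpace n) (z v : CSpace n) :
    Matrix.vecMul v (jacobian F z) = fderiv ℂ F z v := by
  conv_rhs => rw [← Finset.univ_sum_single v, map_sum]
  ext k
  simp only [Matrix.vecMul, dotProduct, jacobian, Matrix.of_apply, Finset.sum_apply]
  refine Finset.sum_congr rfl fun j _ => ?_
  rw [show (Pi.single j (v j) : CSpace n) = v j • Pi.single j 1 by rw [← Pi.single_smul]; simp,
    map_smul]
  rfl

lemma det_jacobian (F : CSpace n → CSpace n) (z : CSpace n) :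
    (jacobian F z).det = (fderiv ℂ F z).det := by
  have : jacobian F z =
      (LinearMap.toMatrix' (fderiv ℂ F z : CSpace n →ₗ[ℂ] CSpace n)).transpose := by
    ext j k
    simp [jacobian, LinearMap.toMatrix'_apply]
  rw [this, Matrix.det_transpose, LinearMap.det_toMatrix']

lemma differentiableOn_det_fderiv {F : CSpace n → CSpace n} {U : Set (CSpace n)} (hU : IsOpen U)
    (hF : DifferentiableOn ℂ F U) : DifferentiableOn ℂ (fun z => (fderiv ℂ F z).det) U := by
  have h1 : ∀ j k, DifferentiableOn ℂ (fun z => jacobian F z j k) U := fun j k =>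
    differentiableOn_pi.1 (differentiableOn_fderiv_apply hU hF (Pi.single j 1)) k
  simp only [← det_jacobian, Matrix.det_apply']
  refine DifferentiableOn.fun_sum fun s _ => DifferentiableOn.const_mul ?_ _
  intro z hz
  exact (HasFDerivWithinAt.finsetProd fun i _ =>
    (h1 (s i) i z hz).hasFDerivWithinAt).differentiableWithinAt

lemma fderiv_injective_of_det_ne_zero {A : CSpace n →L[ℂ] CSpace n} (h : A.det ≠ 0) :
    Function.Injective A :=
  (LinearEquiv.ofIsUnitDet (f := (A : CSpace n →ₗ[ℂ] CSpace n)) (v := Pi.basisFun ℂ (Fin n))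
    (v' := Pi.basisFun ℂ (Fin n)) (by
      rw [LinearMap.det_toMatrix]; exact isUnit_iff_ne_zero.2 h)).injective

end Jacobian

section Developing

variable {n : ℕ} {M : Type*} [TopologicalSpace M] [ChartedSpace (CSpace n) M]

/-- `b` is a locally biholomorphic map from the open set `X` to `ℂⁿ`: in all local coordinates it
is holomorphic with invertible derivative. -/
structure IsDevelopingMap (X : Set M) (b : M → CSpace n) : Prop where
  isOpen : IsOpen X
  contDiffAt : ∀ e ∈ holCharts (n := n) M, ∀ z ∈ e.target, e.symm z ∈ X →
    ContDiffAt ℂ ω (b ∘ e.symm) z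
  det_ne_zero : ∀ e ∈ holCharts (n := n) M, ∀ z ∈ e.target, e.symm z ∈ X →
    (fderiv ℂ (b ∘ e.symm) z).det ≠ 0

variable {ι : Type*} {φ : ι → TopForm (n := n) M} [IsManifold 𝓘(ℂ, CSpace n) ω M]

lemma mem_regularSet_self (hM : HasBergmanMetric φ) (p : M) :
    p ∈ regularSet φ p := by
  rintro (h | h)
  · exact hM.kernel_ne_zero p h
  · exact (hM.posDef _ (chartAt_mem_holCharts p) p (mem_chart_source _ p)).det_pos.ne' h.2

variable [SecondCountableTopology M] [Nonempty M]
  {e e₁ e₂ e' : OpenPartialHomeomorph M (CSpace n)} {p : M}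

lemma differentiableAt_repMap (hφ : IsBergmanBasis φ) (he : e ∈ holCharts (n := n) M)
    (he' : e' ∈ holCharts (n := n) M) (hp : p ∈ e'.source) {z : CSpace n} (hz : z ∈ e.target)
    (hz' : e.symm z ∉ zeroSet φ p) : DifferentiableAt ℂ (repMap φ p e' ∘ e.symm) z :=
  (differentiableOn_repMap hφ he he' hp).differentiableAt
    ((isOpen_inter_preimage_compl_zeroSet hφ he p).mem_nhds ⟨hz, hz'⟩)

lemma mem_regularSet_iff (hφ : IsBergmanBasis φ) (he : e ∈ holCharts (n := n) M) {x : M}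
    (hx : x ∈ e.source) : x ∈ regularSet φ p ↔ x ∉ zeroSet φ p ∧
      (fderiv ℂ (repMap φ p (chartAt (CSpace n) p) ∘ e.symm) (e x)).det ≠ 0 := by
  set c := chartAt (CSpace n) x
  have hc : c ∈ holCharts (n := n) M := chartAt_mem_holCharts x
  have hxc : x ∈ c.source := mem_chart_source _ x
  have hp := mem_chart_source (CSpace n) p
  have hq := chartAt_mem_holCharts (n := n) p
  have key : x ∉ zeroSet φ p → ((metricMatrix φ c (chartAt (CSpace n) p) (c x)
      (chartAt (CSpace n) p p)).det = 0 ↔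
      (fderiv ℂ (repMap φ p (chartAt (CSpace n) p) ∘ e.symm) (e x)).det = 0) := by
    intro hx0
    have hm : e x ∈ e.target ∩ e.symm ⁻¹' c.source := by simp [hx, hxc]
    rw [metricMatrix_eq_jacobian hφ hc hq hp ⟨c.map_source hxc, by simpa [hxc] using hx0⟩,
      det_jacobian]
    have hev : repMap φ p (chartAt (CSpace n) p) ∘ e.symm =ᶠ[𝓝 (e x)]
        (repMap φ p (chartAt (CSpace n) p) ∘ c.symm) ∘ (c ∘ e.symm) := by
      filter_upwards [(isOpen_transition_source c e).mem_nhds hm] with w hw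
      simp [c.left_inv hw.2]
    have hcx : (c ∘ e.symm) (e x) = c x := by simp [hx]
    have hd := differentiableAt_repMap hφ hc hq hp (z := c x) (c.map_source hxc)
      (by simpa [hxc] using hx0)
    rw [hev.fderiv_eq, fderiv_comp _ (by rwa [hcx]) (differentiableAt_transition hc he hm), hcx]
    simp only [ContinuousLinearMap.det, ContinuousLinearMap.toLinearMap_comp, LinearMap.det_comp]
    have := det_fderiv_transition_ne_zero hc he hm
    rw [ContinuousLinearMap.det] at this
    simp [this]
  rw [regularSet, mem_compl_iff, mem_union, not_or, degenerateSet]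
  simp only [mem_ofPred_eq, not_and]
  constructor
  · rintro ⟨h1, h2⟩
    exact ⟨h1, fun h => h2 h1 ((key h1).2 h)⟩
  · rintro ⟨h1, h2⟩
    exact ⟨h1, fun _ h => h2 ((key h1).1 h)⟩

lemma isOpen_regularSet (hφ : IsBergmanBasis φ) (p : M) : IsOpen (regularSet φ p) := by
  rw [isOpen_iff_mem_nhds]
  intro x hx
  set e := chartAt (CSpace n) x
  have he : e ∈ holCharts (n := n) M := chartAt_mem_holCharts x
  have hxe : x ∈ e.source := mem_chart_source _ x
  have hp := mem_chart_source (CSpace n) p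
  have hq := chartAt_mem_holCharts (n := n) p
  have hU := isOpen_inter_preimage_compl_zeroSet hφ he p
  have h1 := (differentiableOn_det_fderiv hU
    (differentiableOn_repMap hφ he hq hp)).continuousOn.isOpen_inter_preimage hU
    (isOpen_compl_singleton (x := (0 : ℂ)))
  have hx' := (mem_regularSet_iff hφ he hxe).1 hx
  refine mem_of_superset ((e.isOpen_inter_preimage h1).mem_nhds
    ⟨hxe, ⟨e.map_source hxe, ?_⟩, hx'.2⟩) fun y hy => ?_
  · rw [mem_preimage, e.left_inv hxe]; exact hx'.1
  · refine (mem_regularSet_iff hφ he hy.1).2 ⟨?_, hy.2.2⟩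
    have := hy.2.1.2
    rwa [mem_preimage, e.left_inv hy.1] at this

/-- On `M^p`, the derivatives of `log K*(·, w̄)` with respect to `w̄` at `p` define a locally
biholomorphic map. -/
lemma isDevelopingMap_repMap (hφ : IsBergmanBasis φ) (p : M) :
    IsDevelopingMap (regularSet φ p) (repMap φ p (chartAt (CSpace n) p)) where
  isOpen := isOpen_regularSet hφ p
  contDiffAt e he z hz hzX := by
    have h0 : e.symm z ∉ zeroSet φ p := fun h => hzX (Or.inl h)
    have hU := isOpen_inter_preimage_compl_zeroSet hφ he p
    exact (contDiffOn_of_differentiableOn hU (differentiableOn_repMap hφ he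
      (chartAt_mem_holCharts p) (mem_chart_source _ p)) ω).contDiffAt (hU.mem_nhds ⟨hz, h0⟩)
  det_ne_zero e he z hz hzX := by
    have := ((mem_regularSet_iff hφ he (e.map_target hz)).1 hzX).2
    rwa [e.right_inv hz] at this

/-- A change of the coordinates at `p` changes the developing map by an affine transformation,
whose linear part is the conjugate of the Jacobian matrix of the change of coordinates; the constant
comes from the factor by which `dw_1 ∧ ⋯ ∧ dw_n` changes. -/
lemma exists_repMap_eq_affine (hφ : IsBergmanBasis φ) (h₁ : e₁ ∈ holCharts (n := n) M)
    (h₂ : e₂ ∈ holCharts (n := n) M) (hp₁ : p ∈ e₁.source) (hp₂ : p ∈ e₂.source) :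
    ∃ (T : CSpace n ≃L[ℂ] CSpace n) (c : CSpace n), ∀ x ∉ zeroSet φ p,
      repMap φ p e₂ x = T (repMap φ p e₁ x) + c := by
  set σ := e₁ ∘ e₂.symm with hσ
  set w := e₂ p with hw
  have hwt : w ∈ e₂.target ∩ e₂.symm ⁻¹' e₁.source := by simp [hw, hp₁, hp₂]
  have hσw : σ w = e₁ p := by simp [hσ, hw, hp₂]
  have hW := isOpen_transition_source e₁ e₂
  have hσd : DifferentiableOn ℂ σ (e₂.target ∩ e₂.symm ⁻¹' e₁.source) :=
    (contDiffOn_transition h₁ h₂).differentiableOn (by simp)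
  have hδ0 := det_fderiv_transition_ne_zero h₁ h₂ hwt
  set δ : CSpace n → ℂ := fun w => (fderiv ℂ σ w).det with hδ
  have hδd : DifferentiableAt ℂ δ w :=
    (differentiableOn_det_fderiv hW hσd).differentiableAt (hW.mem_nhds hwt)
  set P : Matrix (Fin n) (Fin n) ℂ := (starRingEnd ℂ).mapMatrix (jacobian σ w) with hP
  have hPdet : P.det ≠ 0 := by
    rw [hP, ← RingHom.map_det, det_jacobian]
    exact (map_ne_zero _).2 hδ0
  have hPinj : Function.Injective (Matrix.mulVecLin P) :=
    Matrix.mulVec_injective_iff_isUnit.2 ((Matrix.isUnit_iff_isUnit_det _).2 hPdet.isUnit)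
  refine ⟨(LinearEquiv.ofInjectiveEndo _ hPinj).toContinuousLinearEquiv,
    fun k => conj (fderiv ℂ δ w (Pi.single k 1)) / conj (δ w), fun x hx => ?_⟩
  set e := chartAt (CSpace n) x
  have he : e ∈ holCharts (n := n) M := chartAt_mem_holCharts x
  have hxe : x ∈ e.source := mem_chart_source _ x
  have hz := e.map_source hxe
  have hK1 : kernelFun φ e e₁ (e x) (e₁ p) ≠ 0 := fun h =>
    hx ((mem_zeroSet_iff_kernelFun he hxe h₁ hp₁).2 h)
  set v := coeffVector φ e (e x) with hv
  set Φ := coeffVector φ e₁ with hΦ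
  have hΦd : DifferentiableAt ℂ Φ (σ w) := (differentiableOn_coeffVector hφ h₁).differentiableAt
    (e₁.open_target.mem_nhds (by rw [hσw]; exact e₁.map_source hp₁))
  have hσdw : DifferentiableAt ℂ σ w := hσd.differentiableAt (hW.mem_nhds hwt)
  have hK2 : ∀ w' ∈ e₂.target ∩ e₂.symm ⁻¹' e₁.source,
      kernelFun φ e e₂ (e x) w' = inner ℂ (δ w' • Φ (σ w')) v := by
    intro w' hw'
    have h := kernelFun_eq_inner hφ he h₁ hz (e₁.map_source hw'.2)
    rw [inner_smul_left]
    refine Eq.trans ?_ (congrArg (fun t => conj (δ w') * t) h)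
    change ∑' j, _ * conj (formCoeff (φ j) e₂ w') =
      _ * ∑' j, _ * conj (formCoeff (φ j) e₁ (e₁ (e₂.symm w')))
    rw [← tsum_mul_left]
    refine tsum_congr fun j => ?_
    rw [formCoeff_transition (φ j) h₁ h₂ hw', map_mul]
    ring
  have hd1 : ∀ l, dbar l (fun w' => kernelFun φ e e₁ (e x) w') (e₁ p) =
      inner ℂ (fderiv ℂ Φ (σ w) (Pi.single l 1)) v := fun l => by
    rw [dbar_kernelFun hφ he h₁ hz (e₁.map_source hp₁), hσw]
  have hG : HasFDerivAt (fun w' => δ w' • Φ (σ w'))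
      (δ w • (fderiv ℂ Φ (σ w)).comp (fderiv ℂ σ w) + (fderiv ℂ δ w).smulRight (Φ (σ w))) w :=
    hδd.hasFDerivAt.smul (hΦd.hasFDerivAt.comp w hσdw.hasFDerivAt)
  ext k
  have hd2 : dbar k (fun w' => kernelFun φ e e₂ (e x) w') w =
      conj (δ w) * ∑ l, P k l * dbar l (fun w' => kernelFun φ e e₁ (e x) w') (e₁ p) +
        conj (fderiv ℂ δ w (Pi.single k 1)) * kernelFun φ e e₁ (e x) (e₁ p) := by
    rw [dbar_congr (G := fun w' => inner ℂ (δ w' • Φ (σ w')) v) (by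
      filter_upwards [hW.mem_nhds hwt] with w' hw' using hK2 w' hw'),
      dbar_inner k hG.differentiableAt, hG.fderiv]
    simp only [add_apply, smul_apply,
      ContinuousLinearMap.comp_apply, ContinuousLinearMap.smulRight_apply, inner_add_left,
      inner_smul_left, hd1]
    rw [kernelFun_eq_inner hφ he h₁ hz (e₁.map_source hp₁), hσw]
    congr 2
    have : fderiv ℂ σ w (Pi.single k 1) =
        ∑ l, (fderiv ℂ σ w (Pi.single k 1) l) • (Pi.single l 1 : CSpace n) :=
      pi_eq_sum_univ' _
    rw [this, map_sum, sum_inner]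
    refine Finset.sum_congr rfl fun l _ => ?_
    rw [map_smul, inner_smul_left]
    rfl
  have hd2' : kernelFun φ e e₂ (e x) w = conj (δ w) * kernelFun φ e e₁ (e x) (e₁ p) := by
    rw [hK2 w hwt, inner_smul_left, hσw, kernelFun_eq_inner hφ he h₁ hz (e₁.map_source hp₁)]
  have hcδ : conj (δ w) ≠ 0 := (map_ne_zero _).2 hδ0
  change dbar k (fun w' => kernelFun φ e e₂ (e x) w') w / kernelFun φ e e₂ (e x) w =
    (∑ l, P k l * (dbar l (fun w' => kernelFun φ e e₁ (e x) w') (e₁ p) /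
      kernelFun φ e e₁ (e x) (e₁ p))) + _
  rw [hd2, hd2']
  simp only [mul_div_assoc', ← Finset.sum_div]
  field_simp

end Developing

/-! ### Lifts of line segments through local homeomorphisms -/

section LocalHomeo

variable {M E : Type*} [TopologicalSpace M] [TopologicalSpace E] {X : Set M} {b : M → E}

/-- `b` is a local homeomorphism at each point of the open set `X`. -/
structure IsLocalHomeoOn (X : Set M) (b : M → E) : Prop where
  isOpen : IsOpen X
  exists_chart : ∀ x ∈ X, ∃ ψ : OpenPartialHomeomorph M E,
    x ∈ ψ.source ∧ ψ.source ⊆ X ∧ EqOn b ψ ψ.source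

namespace IsLocalHomeoOn

lemma continuousAt (hb : IsLocalHomeoOn X b) {x : M} (hx : x ∈ X) : ContinuousAt b x := by
  obtain ⟨ψ, hxψ, -, hψ⟩ := hb.exists_chart x hx
  exact (ψ.continuousAt hxψ).congr
    (by filter_upwards [ψ.open_source.mem_nhds hxψ] with y hy using (hψ hy).symm)

lemma isLocallyInjective (hb : IsLocalHomeoOn X b) : IsLocallyInjective fun x : X => b x := by
  rintro ⟨x, hx⟩
  obtain ⟨ψ, hxψ, -, hψ⟩ := hb.exists_chart x hx
  refine ⟨Subtype.val ⁻¹' ψ.source, ψ.open_source.preimage continuous_subtype_val, hxψ, ?_⟩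
  intro y hy z hz hyz
  refine Subtype.ext (ψ.injOn hy hz ?_)
  rw [← hψ hy, ← hψ hz]
  exact hyz

/-- Lifts of paths through a local homeomorphism are unique. -/
lemma eqOn_of_lift [T2Space M] (hb : IsLocalHomeoOn X b) {K : Set ℝ} (hK : IsPreconnected K)
    {γ₁ γ₂ : ℝ → M} (h₁ : ContinuousOn γ₁ K) (h₂ : ContinuousOn γ₂ K) (m₁ : ∀ t ∈ K, γ₁ t ∈ X)
    (m₂ : ∀ t ∈ K, γ₂ t ∈ X) (h : ∀ t ∈ K, b (γ₁ t) = b (γ₂ t)) {t₀ : ℝ} (ht₀ : t₀ ∈ K)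
    (h0 : γ₁ t₀ = γ₂ t₀) : EqOn γ₁ γ₂ K := by
  have := isPreconnected_iff_preconnectedSpace.1 hK
  have key := (T2Space.isSeparatedMap fun x : X => b x).eq_of_comp_eq hb.isLocallyInjective
    (A := K) (g₁ := fun t : K => (⟨γ₁ t, m₁ t t.2⟩ : X)) (g₂ := fun t : K => (⟨γ₂ t, m₂ t t.2⟩ : X))
    (h₁.domRestrict.subtype_mk _) (h₂.domRestrict.subtype_mk _)
    (funext fun t => h t t.2) ⟨t₀, ht₀⟩ (Subtype.ext h0)
  intro t ht
  exact congrArg Subtype.val (congrFun key ⟨t, ht⟩)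

/-- A local homeomorphism that is injective on an open set maps it homeomorphically onto an open
subset of the target. -/
lemma exists_openPartialHomeomorph [Nonempty M] (hb : IsLocalHomeoOn X b) {N : Set M}
    (hN : IsOpen N) (hNX : N ⊆ X) (hinj : InjOn b N) :
    ∃ ψ : OpenPartialHomeomorph M E, ψ.source = N ∧ ⇑ψ = b := by
  refine ⟨OpenPartialHomeomorph.ofContinuousOpenRestrict (hinj.toPartialEquiv b N)
    (fun x hx => (hb.continuousAt (hNX hx)).continuousWithinAt) ?_ hN, rfl, rfl⟩
  refine isOpenMap_iff_nhds_le.2 ?_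
  rintro ⟨x, hx⟩
  obtain ⟨ψ, hxψ, -, hψ⟩ := hb.exists_chart x (hNX hx)
  have h1 : map b (𝓝 x) = 𝓝 (b x) := by
    have h2 := ψ.map_nhds_eq hxψ
    rw [← hψ hxψ] at h2
    rw [← h2]
    exact map_congr (by filter_upwards [ψ.open_source.mem_nhds hxψ] with y hy using hψ hy)
  have h3 : map ((hinj.toPartialEquiv b N).source.domRestrict (hinj.toPartialEquiv b N))
      (𝓝 ⟨x, hx⟩) = map b (map Subtype.val (𝓝 (⟨x, hx⟩ : N))) := rfl
  rw [h3, hN.isOpenEmbedding_subtypeVal.map_nhds_eq, h1]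
  rfl

end IsLocalHomeoOn

end LocalHomeo

section LineLifts

variable {M E : Type*} [TopologicalSpace M] [NormedAddCommGroup E] [NormedSpace ℝ E]
  {X : Set M} {b : M → E}

/-- `γ` is a path in `X`, defined on an open interval `J` that contains `[0, 1]`, that starts at `q`
and that `b` maps to the line with direction `v`, with constant velocity. -/
structure IsLineLift (X : Set M) (b : M → E) (q : M) (v : E) (γ : ℝ → M) (J : Set ℝ) : Prop where
  isOpen : IsOpen J
  ordConnected : J.OrdConnected
  subset : Icc 0 1 ⊆ J
  continuousOn : ContinuousOn γ J
  mem : ∀ t ∈ J, γ t ∈ X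
  zero : γ 0 = q
  map : ∀ t ∈ J, b (γ t) = b q + t • v

/-- `x` is the endpoint at time `1` of a lift of the line from `b q` with direction `v`. -/
def IsLineLiftEnd (X : Set M) (b : M → E) (q : M) (v : E) (x : M) : Prop :=
  ∃ γ J, IsLineLift X b q v γ J ∧ γ 1 = x

namespace IsLineLift

variable {q : M} {v : E} {γ : ℝ → M} {J : Set ℝ}

lemma zero_mem (h : IsLineLift X b q v γ J) : (0 : ℝ) ∈ J := h.subset (by simp)

lemma one_mem (h : IsLineLift X b q v γ J) : (1 : ℝ) ∈ J := h.subset (by simp)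

end IsLineLift

lemma IsLineLiftEnd.map_eq {q x : M} {v : E} (h : IsLineLiftEnd X b q v x) : b x = b q + v := by
  obtain ⟨γ, J, h, rfl⟩ := h
  simpa using h.map 1 h.one_mem

lemma IsLineLiftEnd.mem {q x : M} {v : E} (h : IsLineLiftEnd X b q v x) : x ∈ X := by
  obtain ⟨γ, J, h, rfl⟩ := h
  exact h.mem 1 h.one_mem

lemma isLineLift_const {q : M} (hq : q ∈ X) : IsLineLift X b q 0 (fun _ => q) univ where
  isOpen := isOpen_univ
  ordConnected := ordConnected_univ
  subset := subset_univ _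
  continuousOn := continuousOn_const
  mem _ _ := hq
  zero := rfl
  map _ _ := by simp

namespace IsLocalHomeoOn

lemma lineLift_eqOn [T2Space M] (hb : IsLocalHomeoOn X b) {q : M} {v : E} {γ₁ γ₂ : ℝ → M}
    {J₁ J₂ : Set ℝ} (h₁ : IsLineLift X b q v γ₁ J₁) (h₂ : IsLineLift X b q v γ₂ J₂) :
    EqOn γ₁ γ₂ (J₁ ∩ J₂) :=
  hb.eqOn_of_lift (h₁.ordConnected.inter h₂.ordConnected).isPreconnected
    (h₁.continuousOn.mono inter_subset_left) (h₂.continuousOn.mono inter_subset_right)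
    (fun t ht => h₁.mem t ht.1) (fun t ht => h₂.mem t ht.2)
    (fun t ht => by rw [h₁.map t ht.1, h₂.map t ht.2]) ⟨h₁.zero_mem, h₂.zero_mem⟩
    (by rw [h₁.zero, h₂.zero])

lemma lineLiftEnd_unique [T2Space M] (hb : IsLocalHomeoOn X b) {q x y : M} {v : E}
    (hx : IsLineLiftEnd X b q v x) (hy : IsLineLiftEnd X b q v y) : x = y := by
  obtain ⟨γ₁, J₁, h₁, rfl⟩ := hx
  obtain ⟨γ₂, J₂, h₂, rfl⟩ := hy
  exact hb.lineLift_eqOn h₁ h₂ ⟨h₁.one_mem, h₂.one_mem⟩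

/-- Near the endpoint of a lifted line segment there is an open set on which `b` is injective and
in which all lines with nearby directions have lifts that end there. For the proof, `b` is injective
on the compact lifted segment, hence on a neighbourhood of it. -/
lemma exists_isOpen_lineLiftEnd [Nonempty M] [T2Space M] (hb : IsLocalHomeoOn X b) {q x : M} {v : E}
    (hx : IsLineLiftEnd X b q v x) :
    ∃ N, IsOpen N ∧ N ⊆ X ∧ x ∈ N ∧ InjOn b N ∧
      ∀ᶠ v' in 𝓝 v, ∃ x' ∈ N, IsLineLiftEnd X b q v' x' := by
  obtain ⟨γ, J, hγ, rfl⟩ := hx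
  set C := γ '' Icc 0 1 with hC
  have hCX : C ⊆ X := by
    rintro _ ⟨t, ht, rfl⟩
    exact hγ.mem t (hγ.subset ht)
  have hCc : IsCompact C := isCompact_Icc.image_of_continuousOn (hγ.continuousOn.mono hγ.subset)
  have hinjC : InjOn b C := by
    rintro _ ⟨t, ht, rfl⟩ _ ⟨s, hs, rfl⟩ hts
    rw [hγ.map t (hγ.subset ht), hγ.map s (hγ.subset hs), add_right_inj] at hts
    by_cases hv : v = 0
    · subst hv
      have hc := hb.lineLift_eqOn hγ (isLineLift_const (b := b) (by
        simpa [hγ.zero] using hγ.mem 0 hγ.zero_mem))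
      rw [hc ⟨hγ.subset ht, mem_univ _⟩, hc ⟨hγ.subset hs, mem_univ _⟩]
    · rw [smul_left_injective ℝ hv hts]
  obtain ⟨N₀, hN₀, hCN₀, hinj₀⟩ := hinjC.exists_isOpen_superset hCc
    (fun x hx => hb.continuousAt (hCX hx)) fun x hx => by
      obtain ⟨ψ, hxψ, -, hψ⟩ := hb.exists_chart x (hCX hx)
      exact ⟨ψ.source, ψ.open_source.mem_nhds hxψ, ψ.injOn.congr hψ.symm⟩
  have hN : IsOpen (N₀ ∩ X) := hN₀.inter hb.isOpen
  obtain ⟨ψ, hψN, hψb⟩ := hb.exists_openPartialHomeomorph hN inter_subset_right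
    (hinj₀.mono inter_subset_left)
  have hCψ : C ⊆ ψ.source := by rw [hψN]; exact subset_inter hCN₀ hCX
  have hqψ : q ∈ ψ.source := hCψ ⟨0, by simp, hγ.zero⟩
  refine ⟨ψ.source, ψ.open_source, hψN ▸ inter_subset_right, hCψ ⟨1, by simp, rfl⟩,
    hψb ▸ ψ.injOn, ?_⟩
  -- the tube lemma: nearby segments, slightly prolonged, stay in the image of the chart
  have hopen : IsOpen {s : ℝ × E | b q + s.1 • s.2 ∈ ψ.target} :=
    ψ.open_target.preimage (by fun_prop)
  obtain ⟨I, W, hI, hW, hIs, hvW, hIW⟩ := generalized_tube_lemma (isCompact_Icc (a := (0 : ℝ))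
    (b := 1)) (isCompact_singleton (x := v)) hopen (by
      rintro ⟨t, w⟩ ⟨ht, rfl⟩
      have := ψ.map_source (hCψ ⟨t, ht, rfl⟩)
      rwa [hψb, hγ.map t (hγ.subset ht)] at this)
  obtain ⟨ε, hε, hεI⟩ := isCompact_Icc.exists_thickening_subset_open hI hIs
  have hJI : Ioo (-ε) (1 + ε) ⊆ I := fun t ht => hεI <| by
    rw [mem_thickening_iff]
    refine ⟨max 0 (min t 1), by simp, ?_⟩
    rw [Real.dist_eq, abs_lt]
    obtain ⟨h1, h2⟩ := ht
    rcases le_total t 0 with h | h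
    · rw [min_eq_left (by linarith), max_eq_left h]; constructor <;> linarith
    · rcases le_total t 1 with h' | h'
      · rw [min_eq_left h', max_eq_right h]; constructor <;> linarith
      · rw [min_eq_right h', max_eq_right zero_le_one]; constructor <;> linarith
  filter_upwards [hW.mem_nhds (hvW rfl)] with v' hv'
  have hmem : ∀ t ∈ Ioo (-ε) (1 + ε), b q + t • v' ∈ ψ.target := fun t ht =>
    hIW (mk_mem_prod (hJI ht) hv')
  refine ⟨ψ.symm (b q + (1 : ℝ) • v'), ψ.map_target (hmem 1 ⟨by linarith, by linarith⟩),
    fun t => ψ.symm (b q + t • v'), Ioo (-ε) (1 + ε), ⟨isOpen_Ioo, ordConnected_Ioo,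
      fun t ht => ⟨by linarith [ht.1], by linarith [ht.2]⟩, ?_, ?_, ?_, ?_⟩, rfl⟩
  · exact ψ.continuousOn_symm.comp (by fun_prop) hmem
  · intro t ht
    have := ψ.map_target (hmem t ht)
    rw [hψN] at this
    exact this.2
  · simp only [zero_smul, add_zero]
    rw [← hψb]; exact ψ.left_inv hqψ
  · intro t ht
    have := ψ.right_inv (hmem t ht)
    rwa [hψb] at this

/-- The directions of the lines from `b q` that have lifts up to time `1` form an open set. -/
lemma isOpen_setOf_exists_lineLiftEnd [Nonempty M] [T2Space M] (hb : IsLocalHomeoOn X b) (q : M) :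
    IsOpen {v | ∃ x, IsLineLiftEnd X b q v x} := by
  rw [isOpen_iff_mem_nhds]
  rintro v ⟨x, hx⟩
  obtain ⟨N, -, -, -, -, hN⟩ := hb.exists_isOpen_lineLiftEnd hx
  filter_upwards [hN] with v' hv'
  obtain ⟨x', -, hx'⟩ := hv'
  exact ⟨x', hx'⟩

lemma isOpen_setOf_lineLiftEnd [Nonempty M] [T2Space M] (hb : IsLocalHomeoOn X b) (q : M) :
    IsOpen {x | ∃ v, IsLineLiftEnd X b q v x} := by
  rw [isOpen_iff_mem_nhds]
  rintro x ⟨v, hx⟩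
  obtain ⟨N, hN, hNX, hxN, hinj, hW⟩ := hb.exists_isOpen_lineLiftEnd hx
  have hcont : Tendsto (fun y => b y - b q) (𝓝 x) (𝓝 v) := by
    have : Tendsto (fun y => b y - b q) (𝓝 x) (𝓝 (b x - b q)) :=
      (hb.continuousAt (hNX hxN)).sub_const (b q)
    rwa [hx.map_eq, add_sub_cancel_left] at this
  filter_upwards [hN.mem_nhds hxN, hcont.eventually hW] with y hyN hy
  obtain ⟨x', hx'N, hx'⟩ := hy
  refine ⟨_, (?_ : x' = y) ▸ hx'⟩
  exact hinj hx'N hyN (by rw [hx'.map_eq]; abel)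

end IsLocalHomeoOn

end LineLifts

/-! ### Charts and derivatives from developing maps -/

section Developing

variable {n : ℕ} {M : Type*} [TopologicalSpace M] [ChartedSpace (CSpace n) M]
  {X : Set M} {b : M → CSpace n} {e : OpenPartialHomeomorph M (CSpace n)}

lemma coe_toContinuousLinearEquivOfDetNeZero_apply {A : CSpace n →L[ℂ] CSpace n} (h : A.det ≠ 0)
    (v : CSpace n) : A.toContinuousLinearEquivOfDetNeZero h v = A v :=
  DFunLike.congr_fun (A.coe_toContinuousLinearEquivOfDetNeZero h) v

/-- The isomorphism `L` of the tangent space at `q` with `ℂⁿ` is the derivative of `b` at `q`. -/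
def IsDerivEquiv (b : M → CSpace n) (q : M)
    (L : TangentSpace 𝓘(ℂ, CSpace n) q ≃L[ℂ] CSpace n) : Prop :=
  ∀ e ∈ holCharts (n := n) M, q ∈ e.source → ∀ ζ,
    L ζ = fderiv ℂ (b ∘ e.symm) (e q) (chartCoord e q ζ)

namespace IsDevelopingMap

lemma hasFDerivAt_equiv (hb : IsDevelopingMap X b) (he : e ∈ holCharts (n := n) M) {z : CSpace n}
    (hz : z ∈ e.target) (hzX : e.symm z ∈ X) : HasFDerivAt (b ∘ e.symm)
      (((fderiv ℂ (b ∘ e.symm) z).toContinuousLinearEquivOfDetNeZero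
        (hb.det_ne_zero e he z hz hzX) : CSpace n ≃L[ℂ] CSpace n) : CSpace n →L[ℂ] CSpace n) z := by
  rw [ContinuousLinearMap.coe_toContinuousLinearEquivOfDetNeZero]
  exact ((hb.contDiffAt e he z hz hzX).differentiableAt (by simp)).hasFDerivAt

/-- The inverse function theorem for a developing map, in coordinates. -/
lemma exists_local_inverse (hb : IsDevelopingMap X b) (he : e ∈ holCharts (n := n) M)
    {z : CSpace n} (hz : z ∈ e.target) (hzX : e.symm z ∈ X) :
    ∃ f : OpenPartialHomeomorph (CSpace n) (CSpace n), z ∈ f.source ∧ ⇑f = b ∘ e.symm ∧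
      ContDiffAt ℂ ω f.symm (f z) := by
  have h1 := hb.contDiffAt e he z hz hzX
  have h2 := hb.hasFDerivAt_equiv he hz hzX
  refine ⟨h1.toOpenPartialHomeomorph _ h2 (by simp),
    h1.mem_toOpenPartialHomeomorph_source h2 (by simp),
    rfl, ?_⟩
  exact h1.to_localInverse h2 (by simp)

lemma isLocalHomeoOn [IsManifold 𝓘(ℂ, CSpace n) ω M] (hb : IsDevelopingMap X b) :
    IsLocalHomeoOn X b where
  isOpen := hb.isOpen
  exists_chart x hx := by
    have hxe := mem_chart_source (CSpace n) x
    obtain ⟨f, hf, hfb, -⟩ := hb.exists_local_inverse (chartAt_mem_holCharts (n := n) x)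
      ((chartAt (CSpace n) x).map_source hxe) (by rwa [(chartAt (CSpace n) x).left_inv hxe])
    refine ⟨((chartAt (CSpace n) x).trans f).restrOpen X hb.isOpen, ?_, ?_, ?_⟩
    · simp [hxe, hf, hx]
    · simp
    · intro y hy
      simp only [OpenPartialHomeomorph.restrOpen_source, OpenPartialHomeomorph.trans_source,
        mem_inter_iff, mem_preimage] at hy
      simp [hfb, (chartAt (CSpace n) x).left_inv hy.1.1]

/-- The restrictions of a developing map to open sets on which it is injective are holomorphic
charts. -/
lemma mem_holCharts [IsManifold 𝓘(ℂ, CSpace n) ω M] (hb : IsDevelopingMap X b)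
    {ψ : OpenPartialHomeomorph M (CSpace n)} (hψX : ψ.source ⊆ X) {c : CSpace n}
    (hψ : ∀ x ∈ ψ.source, ψ x = b x - c) : ψ ∈ holCharts (n := n) M := by
  have key : ∀ e ∈ atlas (CSpace n) M, e.symm ≫ₕ ψ ∈ contDiffGroupoid ω 𝓘(ℂ, CSpace n) := by
    intro e hea
    have he : e ∈ holCharts (n := n) M := IsManifold.subset_maximalAtlas hea
    have hev : ∀ z ∈ (e.symm ≫ₕ ψ).source,
        ⇑(e.symm ≫ₕ ψ) =ᶠ[𝓝 z] fun z => (b ∘ e.symm) z - c := by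
      intro z hz
      filter_upwards [(e.symm ≫ₕ ψ).open_source.mem_nhds hz] with w hw
      simp only [OpenPartialHomeomorph.trans_source, OpenPartialHomeomorph.symm_source,
        mem_inter_iff, mem_preimage] at hw
      simp [hψ _ hw.2]
    have hmem : ∀ z ∈ (e.symm ≫ₕ ψ).source, z ∈ e.target ∧ e.symm z ∈ X := by
      intro z hz
      simp only [OpenPartialHomeomorph.trans_source, OpenPartialHomeomorph.symm_source,
        mem_inter_iff, mem_preimage] at hz
      exact ⟨hz.1, hψX hz.2⟩
    have hcd : ∀ z ∈ (e.symm ≫ₕ ψ).source, ContDiffAt ℂ ω (e.symm ≫ₕ ψ) z := fun z hz =>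
      ((hb.contDiffAt e he z (hmem z hz).1 (hmem z hz).2).sub
        contDiffAt_const).congr_of_eventuallyEq
        (hev z hz)
    refine mem_contDiffGroupoid_iff.2 ⟨fun z hz => (hcd z hz).contDiffWithinAt, fun w hw => ?_⟩
    set z := (e.symm ≫ₕ ψ).symm w
    have hz : z ∈ (e.symm ≫ₕ ψ).source := (e.symm ≫ₕ ψ).map_target hw
    have hd := ((hb.hasFDerivAt_equiv he (hmem z hz).1 (hmem z hz).2).sub_const
      c).congr_of_eventuallyEq
      (hev z hz)
    exact ((e.symm ≫ₕ ψ).contDiffAt_symm hw hd (hcd z hz)).contDiffWithinAt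
  refine mem_maximalAtlas_iff.2 fun e he => ⟨?_, key e he⟩
  have := (contDiffGroupoid ω 𝓘(ℂ, CSpace n)).symm (key e he)
  rwa [OpenPartialHomeomorph.trans_symm_eq_symm_trans_symm, OpenPartialHomeomorph.symm_symm] at this

lemma exists_isDerivEquiv [IsManifold 𝓘(ℂ, CSpace n) ω M] (hb : IsDevelopingMap X b) {q : M}
    (hq : q ∈ X) : ∃ L, IsDerivEquiv b q L := by
  set c := chartAt (CSpace n) q with hc
  have hch : c ∈ holCharts (n := n) M := chartAt_mem_holCharts q
  have hqc : q ∈ c.source := mem_chart_source _ q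
  have hindep : ∀ e ∈ holCharts (n := n) M, q ∈ e.source → ∀ ζ,
      mfderiv 𝓘(ℂ, CSpace n) 𝓘(ℂ, CSpace n) b q ζ =
        fderiv ℂ (b ∘ e.symm) (e q) (chartCoord e q ζ) := by
    intro e he hqe ζ
    have hev : b =ᶠ[𝓝 q] (b ∘ e.symm) ∘ e := by
      filter_upwards [e.open_source.mem_nhds hqe] with x hx
      simp [e.left_inv hx]
    have hd : DifferentiableAt ℂ (b ∘ e.symm) (e q) :=
      (hb.contDiffAt e he _ (e.map_source hqe) (by rwa [e.left_inv hqe])).differentiableAt (by simp)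
    have h := hev.mfderiv_eq (I := 𝓘(ℂ, CSpace n)) (I' := 𝓘(ℂ, CSpace n))
    rw [mfderiv_comp q hd.mdifferentiableAt
      ((mdifferentiable_of_mem_holCharts he).mdifferentiableAt hqe), mfderiv_eq_fderiv] at h
    exact DFunLike.congr_fun h ζ
  have hdet := hb.det_ne_zero c hch _ (c.map_source hqc) (by rwa [c.left_inv hqc])
  refine ⟨((mdifferentiable_of_mem_holCharts hch).mfderiv hqc).trans
    ((fderiv ℂ (b ∘ c.symm) (c q)).toContinuousLinearEquivOfDetNeZero hdet), fun e he hqe ζ => ?_⟩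
  rw [← hindep e he hqe ζ, hindep c hch hqc ζ]
  exact coe_toContinuousLinearEquivOfDetNeZero_apply hdet _

end IsDevelopingMap

end Developing

section SecondDerivative

variable {n : ℕ}

/-- The chain rule for the second derivative of a holomorphic map along a curve. -/
lemma hasDerivAt_deriv_comp {β : CSpace n → CSpace n} {u : ℝ → CSpace n} {a : CSpace n} {t : ℝ}
    (hβ : ContDiffAt ℂ ω β (u t)) (hu : ∀ᶠ s in 𝓝 t, DifferentiableAt ℝ u s)
    (ha : HasDerivAt (deriv u) a t) :
    HasDerivAt (deriv (β ∘ u))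
      (fderiv ℂ (fderiv ℂ β) (u t) (deriv u t) (deriv u t) + fderiv ℂ β (u t) a) t := by
  have h1 : ∀ᶠ z in 𝓝 (u t), DifferentiableAt ℂ β z :=
    (hβ.eventually (by simp)).mono fun z hz => hz.differentiableAt (by simp)
  have h2 : ∀ᶠ s in 𝓝 t, DifferentiableAt ℂ β (u s) := hu.self_of_nhds.continuousAt.eventually h1
  have h3 : deriv (β ∘ u) =ᶠ[𝓝 t] fun s => fderiv ℂ β (u s) (deriv u s) := by
    filter_upwards [hu, h2] with s hs hs'
    exact ((hs'.hasFDerivAt.restrictScalars ℝ).comp_hasDerivAt s hs.hasDerivAt).deriv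
  have h4 : DifferentiableAt ℂ (fderiv ℂ β) (u t) :=
    (hβ.fderiv_right (m := ω) (by simp)).differentiableAt (by simp)
  have h5 : HasDerivAt (fun s => fderiv ℂ β (u s)) (fderiv ℂ (fderiv ℂ β) (u t) (deriv u t)) t :=
    (h4.hasFDerivAt.restrictScalars ℝ).comp_hasDerivAt t hu.self_of_nhds.hasDerivAt
  refine HasDerivAt.congr_of_eventuallyEq ?_ h3
  have h6 : HasDerivAt (fun s => (fderiv ℂ β (u s)).restrictScalars ℝ)
      ((fderiv ℂ (fderiv ℂ β) (u t) (deriv u t)).restrictScalars ℝ) t :=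
    (ContinuousLinearMap.restrictScalarsL ℂ (CSpace n) (CSpace n) ℝ ℝ).hasFDerivAt.comp_hasDerivAt
      t h5
  exact h6.clm_apply ha

end SecondDerivative

/-! ### Geodesics of the Bochner connection -/

section Christoffel

variable {n : ℕ} {M : Type*} [TopologicalSpace M] [ChartedSpace (CSpace n) M]
  {ι : Type*} {φ : ι → TopForm (n := n) M}

lemma notMem_zeroSet_of_mem_regularSet {p x : M} (hx : x ∈ regularSet φ p) :
    x ∉ zeroSet φ p :=
  fun h => hx (Or.inl h)

variable [IsManifold 𝓘(ℂ, CSpace n) ω M] [SecondCountableTopology M] [Nonempty M]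
  {e : OpenPartialHomeomorph M (CSpace n)} {p : M}

/-- The coefficients `∂g_{km̄}/∂z_l` are the second derivatives of the developing map. -/
lemma dz_metricMatrix (hφ : IsBergmanBasis φ) (he : e ∈ holCharts (n := n) M) {z : CSpace n}
    (hz : z ∈ e.target) (hzX : e.symm z ∈ regularSet φ p) (l k m : Fin n) :
    dz l (fun z' => metricMatrix φ e (chartAt (CSpace n) p) z' (chartAt (CSpace n) p p) k m) z =
      fderiv ℂ (fderiv ℂ (repMap φ p (chartAt (CSpace n) p) ∘ e.symm)) z (Pi.single l 1)
        (Pi.single k 1) m := by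
  set β := repMap φ p (chartAt (CSpace n) p) ∘ e.symm
  have hβ := (isDevelopingMap_repMap hφ p).contDiffAt e he z hz hzX
  have hd : DifferentiableAt ℂ (fderiv ℂ β) z :=
    (hβ.fderiv_right (m := ω) (by simp)).differentiableAt (by simp)
  have hev : (fun z' => metricMatrix φ e (chartAt (CSpace n) p) z' (chartAt (CSpace n) p p) k m)
      =ᶠ[𝓝 z] fun z' => fderiv ℂ β z' (Pi.single k 1) m := by
    filter_upwards [(isOpen_inter_preimage_compl_zeroSet hφ he p).mem_nhds
      ⟨hz, notMem_zeroSet_of_mem_regularSet hzX⟩] with z' hz'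
    rw [metricMatrix_eq_jacobian hφ he (chartAt_mem_holCharts p) (mem_chart_source _ p) hz']
    rfl
  have h1 : HasFDerivAt (fun z' => fderiv ℂ β z' (Pi.single k 1))
      ((fderiv ℂ (fderiv ℂ β) z).flip (Pi.single k 1)) z := by
    simpa using hd.hasFDerivAt.clm_apply (hasFDerivAt_const (Pi.single k 1 : CSpace n) z)
  have h2 : HasFDerivAt (fun z' => fderiv ℂ β z' (Pi.single k 1) m)
      ((ContinuousLinearMap.proj m).comp ((fderiv ℂ (fderiv ℂ β) z).flip (Pi.single k 1))) z :=
    (hasFDerivAt_pi'.1 h1) m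
  rw [dz, hev.lineDeriv_eq, (h2.hasLineDerivAt _).lineDeriv]
  rfl

/-- The derivative of the developing map turns the quadratic form of the Christoffel symbols into
its second derivative; that is, the developing map is affine along the geodesics. -/
lemma fderiv_christoffel (hφ : IsBergmanBasis φ) (he : e ∈ holCharts (n := n) M) {z : CSpace n}
    (hz : z ∈ e.target) (hzX : e.symm z ∈ regularSet φ p) (v : CSpace n) :
    fderiv ℂ (repMap φ p (chartAt (CSpace n) p) ∘ e.symm) z
        (fun j => -∑ k, ∑ l, christoffel φ p e z j k l * v k * v l) =
      -fderiv ℂ (fderiv ℂ (repMap φ p (chartAt (CSpace n) p) ∘ e.symm)) z v v := by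
  have hdet := (isDevelopingMap_repMap hφ p).det_ne_zero e he z hz hzX
  simp only [christoffel, dz_metricMatrix hφ he hz hzX]
  rw [metricMatrix_eq_jacobian hφ he (chartAt_mem_holCharts p) (mem_chart_source _ p)
    ⟨hz, notMem_zeroSet_of_mem_regularSet hzX⟩]
  set β := repMap φ p (chartAt (CSpace n) p) ∘ e.symm
  set D := fderiv ℂ (fderiv ℂ β) z with hD
  have hv : ∀ w : CSpace n, w = ∑ i, w i • (Pi.single i 1 : CSpace n) := fun w =>
    pi_eq_sum_univ' w
  have h1 : D v v = fun m => ∑ k, ∑ l, D (Pi.single l 1) (Pi.single k 1) m * v k * v l := by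
    conv_lhs => rw [hv v]
    simp only [map_sum, map_smul, _root_.sum_apply, _root_.smul_apply]
    ext m
    simp only [Finset.sum_apply, Pi.smul_apply, smul_eq_mul, Finset.mul_sum]
    refine Finset.sum_congr rfl fun k _ => ?_
    refine Finset.sum_congr rfl fun l _ => ?_
    ring
  have h2 : (fun j => -∑ k, ∑ l, (∑ m, D (Pi.single l 1) (Pi.single k 1) m * (jacobian β z)⁻¹ m j) *
      v k * v l) = -Matrix.vecMul (D v v) (jacobian β z)⁻¹ := by
    ext j
    rw [h1]
    simp only [Pi.neg_apply, Matrix.vecMul, dotProduct, Finset.sum_mul, neg_inj]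
    symm
    rw [Finset.sum_comm]
    refine Finset.sum_congr rfl fun k _ => ?_
    rw [Finset.sum_comm]
    refine Finset.sum_congr rfl fun l _ => Finset.sum_congr rfl fun m _ => ?_
    ring
  rw [h2, ← vecMul_jacobian, Matrix.neg_vecMul, Matrix.vecMul_vecMul, Matrix.nonsing_inv_mul,
    Matrix.vecMul_one]
  rw [det_jacobian]
  exact hdet.isUnit

end Christoffel

section Curves

lemma comp_symm_comp_eventuallyEq {M E F : Type*} [TopologicalSpace M] [TopologicalSpace E]
    {e : OpenPartialHomeomorph M E} {γ : ℝ → M} (b : M → F) {t : ℝ} (hγ : ContinuousAt γ t)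
    (ht : γ t ∈ e.source) : b ∘ γ =ᶠ[𝓝 t] (b ∘ e.symm) ∘ fun s => e (γ s) := by
  filter_upwards [hγ.eventually (e.open_source.mem_nhds ht)] with s hs
  simp [e.left_inv hs]

lemma eq_add_smul_of_deriv_deriv_eq_zero {E : Type*} [NormedAddCommGroup E] [NormedSpace ℝ E]
    {g : ℝ → E} {J : Set ℝ} (hJ : IsOpen J) (hJ' : IsPreconnected J) (h0 : 0 ∈ J)
    (hg : ∀ t ∈ J, DifferentiableAt ℝ g t) (hg' : ∀ t ∈ J, HasDerivAt (deriv g) 0 t) :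
    ∀ t ∈ J, g t = g 0 + t • deriv g 0 := by
  have h1 : ∀ t ∈ J, deriv g t = deriv g 0 := fun t ht =>
    hJ.is_const_of_deriv_eq_zero hJ'
      (fun s hs => (hg' s hs).differentiableAt.differentiableWithinAt)
      (fun s hs => (hg' s hs).deriv) ht h0
  have h2 : ∀ t ∈ J, HasDerivAt (fun s => g s - s • deriv g 0) 0 t := fun t ht => by
    simpa [h1 t ht] using (hg t ht).hasDerivAt.fun_sub ((hasDerivAt_id t).smul_const (deriv g 0))
  intro t ht
  have h3 := hJ.is_const_of_deriv_eq_zero hJ'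
    (fun s hs => (h2 s hs).differentiableAt.differentiableWithinAt)
    (fun s hs => (h2 s hs).deriv) ht h0
  simp only [zero_smul, sub_zero] at h3
  rw [← h3]
  abel

variable {n : ℕ} {M : Type*} [TopologicalSpace M] [ChartedSpace (CSpace n) M] {X : Set M}
  {b : M → CSpace n} {e : OpenPartialHomeomorph M (CSpace n)} {q : M} {γ : ℝ → M} {J : Set ℝ}
  {v : CSpace n}

namespace IsDevelopingMap

lemma hasDerivAt_comp (hb : IsDevelopingMap X b) (he : e ∈ holCharts (n := n) M) {t : ℝ}
    (hX : γ t ∈ X) (hγ : ContinuousAt γ t) (hte : γ t ∈ e.source) {a : CSpace n}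
    (ha : HasDerivAt (fun s => e (γ s)) a t) :
    HasDerivAt (b ∘ γ) (fderiv ℂ (b ∘ e.symm) (e (γ t)) a) t := by
  refine HasDerivAt.congr_of_eventuallyEq ?_ (comp_symm_comp_eventuallyEq b hγ hte)
  exact (((hb.contDiffAt e he _ (e.map_source hte) (by rwa [e.left_inv hte])).differentiableAt
    (by simp)).hasFDerivAt.restrictScalars ℝ).comp_hasDerivAt t ha

/-- In coordinates, a lifted line is the image of the line under a local inverse of the developing
map. -/
lemma analyticAt_lineLift (hb : IsDevelopingMap X b) (he : e ∈ holCharts (n := n) M)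
    (h : IsLineLift X b q v γ J) {t : ℝ} (ht : t ∈ J) (hte : γ t ∈ e.source) :
    AnalyticAt ℝ (fun s => e (γ s)) t := by
  have hzX : e.symm (e (γ t)) ∈ X := by rw [e.left_inv hte]; exact h.mem t ht
  obtain ⟨f, hf, hfb, hfc⟩ := hb.exists_local_inverse he (e.map_source hte) hzX
  have hγ : ContinuousAt γ t := h.continuousOn.continuousAt (h.isOpen.mem_nhds ht)
  have hu : ContinuousAt (fun s => e (γ s)) t := (e.continuousAt hte).comp hγ
  have hft : f (e (γ t)) = b q + t • v := by
    rw [hfb, Function.comp_apply, e.left_inv hte, h.map t ht]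
  have hev : (fun s => e (γ s)) =ᶠ[𝓝 t] fun s : ℝ => f.symm (b q + s • v) := by
    filter_upwards [hu.eventually (f.open_source.mem_nhds hf), h.isOpen.mem_nhds ht,
      hγ.eventually (e.open_source.mem_nhds hte)] with s hs hsJ hse
    rw [← h.map s hsJ, ← f.left_inv hs, hfb, Function.comp_apply, e.left_inv hse]
  rw [hft] at hfc
  have hl : ContDiffAt ℝ ω (fun s : ℝ => b q + s • v) t := by fun_prop
  have hc : ContDiffAt ℝ ω (fun s : ℝ => f.symm (b q + s • v)) t :=
    ContDiffAt.comp t (hfc.restrict_scalars ℝ) hl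
  exact (hc.congr_of_eventuallyEq hev).analyticAt

end IsDevelopingMap

end Curves

section Geodesics

variable {n : ℕ} {M : Type*} [TopologicalSpace M] [ChartedSpace (CSpace n) M]
  {ι : Type*} {φ : ι → TopForm (n := n) M} [IsManifold 𝓘(ℂ, CSpace n) ω M]
  [SecondCountableTopology M] [Nonempty M] {e : OpenPartialHomeomorph M (CSpace n)} {p q : M}
  {γ : ℝ → M} {J : Set ℝ}

/-- The image of a geodesic under the developing map has no acceleration. -/
lemma IsGeodesicOn.hasDerivAt_deriv (hφ : IsBergmanBasis φ) (hJ : IsOpen J)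
    (h : IsGeodesicOn φ p γ J) {t : ℝ} (ht : t ∈ J) :
    HasDerivAt (deriv (repMap φ p (chartAt (CSpace n) p) ∘ γ)) 0 t ∧
      DifferentiableAt ℝ (repMap φ p (chartAt (CSpace n) p) ∘ γ) t := by
  set b := repMap φ p (chartAt (CSpace n) p)
  set e := chartAt (CSpace n) (γ t)
  have he : e ∈ holCharts (n := n) M := chartAt_mem_holCharts _
  have hte : γ t ∈ e.source := mem_chart_source _ _
  have hγ : ContinuousAt γ t := h.continuousOn.continuousAt (hJ.mem_nhds ht)
  have hz := e.map_source hte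
  have hzX : e.symm (e (γ t)) ∈ regularSet φ p := by
    rw [e.left_inv hte]; exact h.mem_regularSet t ht
  have hβ := (isDevelopingMap_repMap hφ p).contDiffAt e he _ hz hzX
  have hu : ∀ᶠ s in 𝓝 t, DifferentiableAt ℝ (fun s => e (γ s)) s := by
    filter_upwards [hγ.eventually (e.open_source.mem_nhds hte), hJ.mem_nhds ht] with s hs hs'
    exact h.differentiable e he s hs' hs
  have key := hasDerivAt_deriv_comp hβ hu (h.equation e he t ht hte)
  rw [fderiv_christoffel hφ he hz hzX, add_neg_cancel] at key
  have hev := comp_symm_comp_eventuallyEq b hγ hte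
  refine ⟨key.congr_of_eventuallyEq hev.deriv, ?_⟩
  refine DifferentiableAt.congr_of_eventuallyEq ?_ hev
  exact ((hβ.differentiableAt (by simp)).restrictScalars ℝ).comp t hu.self_of_nhds

/-- The geodesics of the Bochner connection are the lifts of the lines through the developing
map. -/
lemma isGeodesicEndpoint_iff (hφ : IsBergmanBasis φ)
    {L : TangentSpace 𝓘(ℂ, CSpace n) q ≃L[ℂ] CSpace n}
    (hL : IsDerivEquiv (repMap φ p (chartAt (CSpace n) p)) q L)
    {ζ : TangentSpace 𝓘(ℂ, CSpace n) q} {x : M} :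
    IsGeodesicEndpoint φ p q ζ x ↔
      IsLineLiftEnd (regularSet φ p) (repMap φ p (chartAt (CSpace n) p)) q (L ζ) x := by
  have hb := isDevelopingMap_repMap hφ p
  set b := repMap φ p (chartAt (CSpace n) p)
  constructor
  · rintro ⟨γ, J, hJ, hJc, hJs, hγ, h0, hζ, h1⟩
    have hJ0 : (0 : ℝ) ∈ J := hJs (by simp)
    have hq : q ∈ regularSet φ p := h0 ▸ hγ.mem_regularSet 0 hJ0
    have hqc := mem_chart_source (CSpace n) q
    have hqh := chartAt_mem_holCharts (n := n) q
    have hlin := eq_add_smul_of_deriv_deriv_eq_zero hJ hJc.isPreconnected hJ0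
      (fun t ht => (hγ.hasDerivAt_deriv hφ hJ ht).2) (fun t ht => (hγ.hasDerivAt_deriv hφ hJ ht).1)
    have hd := hb.hasDerivAt_comp hqh (t := 0) (γ := γ) (by rwa [h0])
      (hγ.continuousOn.continuousAt (hJ.mem_nhds hJ0)) (by rwa [h0]) (hζ _ hqh hqc)
    rw [hd.deriv, h0, ← hL _ hqh hqc] at hlin
    exact ⟨γ, J, ⟨hJ, hJc, hJs, hγ.continuousOn, hγ.mem_regularSet, h0,
      fun t ht => by simpa [h0] using hlin t ht⟩, h1⟩
  · rintro ⟨γ, J, h, h1⟩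
    have hcont : ∀ t ∈ J, ContinuousAt γ t := fun t ht =>
      h.continuousOn.continuousAt (h.isOpen.mem_nhds ht)
    have hlin : ∀ t ∈ J, b ∘ γ =ᶠ[𝓝 t] fun s => b q + s • L ζ := fun t ht => by
      filter_upwards [h.isOpen.mem_nhds ht] with s hs using h.map s hs
    have hder : ∀ s : ℝ, HasDerivAt (fun s : ℝ => b q + s • L ζ) (L ζ) s := fun s => by
      simpa using ((hasDerivAt_id s).smul_const (L ζ)).const_add (b q)
    refine ⟨γ, J, h.isOpen, h.ordConnected, h.subset, ⟨h.continuousOn, h.mem, ?_, ?_⟩,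
      h.zero, ?_, h1⟩
    · intro e he t ht hte
      exact (hb.analyticAt_lineLift he h ht hte).differentiableAt
    · intro e he t ht hte
      have han := hb.analyticAt_lineLift he h ht hte
      have hz := e.map_source hte
      have hzX : e.symm (e (γ t)) ∈ regularSet φ p := by
        rw [e.left_inv hte]; exact h.mem t ht
      have ha := han.deriv.differentiableAt.hasDerivAt
      have key := hasDerivAt_deriv_comp (hb.contDiffAt e he _ hz hzX)
        (han.eventually_analyticAt.mono fun s hs => hs.differentiableAt) ha
      -- the left side of the geodesic equation is mapped to the acceleration of `b ∘ γ`
      have hzero : HasDerivAt (deriv ((b ∘ e.symm) ∘ fun s => e (γ s))) 0 t := by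
        refine (hasDerivAt_const t (L ζ)).congr_of_eventuallyEq ?_
        refine ((comp_symm_comp_eventuallyEq b (hcont t ht) hte).symm.trans
          (hlin t ht)).deriv.trans ?_
        exact Eventually.of_forall fun s => (hder s).deriv
      have heq := key.unique hzero
      rw [add_comm, ← eq_neg_iff_add_eq_zero, ← fderiv_christoffel hφ he hz hzX] at heq
      rwa [fderiv_injective_of_det_ne_zero (hb.det_ne_zero e he _ hz hzX) heq] at ha
    · intro e he hqe
      have hte : γ 0 ∈ e.source := by rwa [h.zero]
      have ha := (hb.analyticAt_lineLift he h h.zero_mem hte).differentiableAt.hasDerivAt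
      have hd := (hb.hasDerivAt_comp he (h.mem 0 h.zero_mem) (hcont 0 h.zero_mem) hte ha).unique
        ((hder 0).congr_of_eventuallyEq (hlin 0 h.zero_mem))
      rw [hL e he hqe, h.zero] at hd
      have hqX : e.symm (e q) ∈ regularSet φ p := by
        rw [e.left_inv hqe, ← h.zero]; exact h.mem 0 h.zero_mem
      rwa [fderiv_injective_of_det_ne_zero
        (hb.det_ne_zero e he _ (e.map_source hqe) hqX) hd] at ha

end Geodesics

/-! ### The exponential map -/

section Exponential

variable {n : ℕ} {M : Type*} [TopologicalSpace M] [ChartedSpace (CSpace n) M]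
  {ι : Type*} {φ : ι → TopForm (n := n) M} [IsManifold 𝓘(ℂ, CSpace n) ω M]
  {e e' : OpenPartialHomeomorph M (CSpace n)} {p q : M}
  {L : TangentSpace 𝓘(ℂ, CSpace n) q ≃L[ℂ] CSpace n}

lemma bergmanRep_eq_vecMul (he' : e' ∈ holCharts (n := n) M) (hp : p ∈ e'.source) (x : M) :
    bergmanRep φ p e' x = Matrix.vecMul (repMap φ p e' x - repMap φ p e' p)
      (metricMatrix φ e' e' (e' p) (e' p))⁻¹ := by
  rw [bergmanRep_eq]
  ext j
  simp only [Matrix.vecMul, dotProduct, dbarLogKernel_eq_repMap he' p (e'.map_source hp),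
    e'.left_inv hp, Pi.sub_apply]
  exact Finset.sum_congr rfl fun k _ => mul_comm _ _

variable [SecondCountableTopology M] [Nonempty M]

lemma exphDomain_eq (hφ : IsBergmanBasis φ)
    (hL : IsDerivEquiv (repMap φ p (chartAt (CSpace n) p)) q L) :
    exphDomain φ p q = L ⁻¹' {v | ∃ x,
      IsLineLiftEnd (regularSet φ p) (repMap φ p (chartAt (CSpace n) p)) q v x} := by
  ext ζ
  simp only [exphDomain, isGeodesicEndpoint_iff hφ hL]
  rfl

/-- With respect to arbitrary coordinates at `p`, the matrix `G(q, p̄)` is, up to the fixed linear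
map `T`, the derivative of the developing map. -/
lemma vecMul_metricMatrix (hφ : IsBergmanBasis φ) (hq : q ∈ regularSet φ p)
    (he : e ∈ holCharts (n := n) M) (hqe : q ∈ e.source) (he' : e' ∈ holCharts (n := n) M)
    (hp : p ∈ e'.source) {T : CSpace n ≃L[ℂ] CSpace n} {c : CSpace n}
    (hT : ∀ x ∉ zeroSet φ p, repMap φ p e' x = T (repMap φ p (chartAt (CSpace n) p) x) + c)
    (v : CSpace n) :
    Matrix.vecMul v (metricMatrix φ e e' (e q) (e' p)) =
      T (fderiv ℂ (repMap φ p (chartAt (CSpace n) p) ∘ e.symm) (e q) v) := by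
  have hm : e q ∈ e.target ∩ e.symm ⁻¹' (zeroSet φ p)ᶜ :=
    ⟨e.map_source hqe, by
      rw [mem_preimage, e.left_inv hqe]; exact notMem_zeroSet_of_mem_regularSet hq⟩
  have hU := isOpen_inter_preimage_compl_zeroSet hφ he p
  have hd := (differentiableOn_repMap hφ he (chartAt_mem_holCharts p)
    (mem_chart_source _ p)).differentiableAt (hU.mem_nhds hm)
  have hev : repMap φ p e' ∘ e.symm =ᶠ[𝓝 (e q)]
      fun z => T ((repMap φ p (chartAt (CSpace n) p) ∘ e.symm) z) + c := by
    filter_upwards [hU.mem_nhds hm] with z hz using hT _ hz.2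
  have hf : HasFDerivAt (fun z => T ((repMap φ p (chartAt (CSpace n) p) ∘ e.symm) z) + c)
      ((T : CSpace n →L[ℂ] CSpace n).comp
        (fderiv ℂ (repMap φ p (chartAt (CSpace n) p) ∘ e.symm) (e q))) (e q) :=
    (T.hasFDerivAt.comp _ hd.hasFDerivAt).add_const c
  rw [metricMatrix_eq_jacobian hφ he he' hp hm, vecMul_jacobian, hev.fderiv_eq, hf.fderiv]
  rfl

lemma isUnit_metricMatrix (hφ : IsBergmanBasis φ) (hq : q ∈ regularSet φ p)
    (he : e ∈ holCharts (n := n) M) (hqe : q ∈ e.source) (he' : e' ∈ holCharts (n := n) M)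
    (hp : p ∈ e'.source) : IsUnit (metricMatrix φ e e' (e q) (e' p)) := by
  obtain ⟨T, c, hT⟩ := exists_repMap_eq_affine hφ (chartAt_mem_holCharts p) he'
    (mem_chart_source _ p) hp
  rw [← Matrix.vecMul_injective_iff_isUnit]
  intro v w hvw
  simp only [vecMul_metricMatrix hφ hq he hqe he' hp hT] at hvw
  exact fderiv_injective_of_det_ne_zero ((isDevelopingMap_repMap hφ p).det_ne_zero e he _
    (e.map_source hqe) (by rwa [e.left_inv hqe])) (T.injective hvw)

variable [T2Space M]

lemma exph_eq (hφ : IsBergmanBasis φ) (hL : IsDerivEquiv (repMap φ p (chartAt (CSpace n) p)) q L)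
    {ζ : TangentSpace 𝓘(ℂ, CSpace n) q} {x : M} (h : IsGeodesicEndpoint φ p q ζ x) :
    exph φ p q ζ = x := by
  have hex : ∃ x, IsGeodesicEndpoint φ p q ζ x := ⟨x, h⟩
  rw [exph, dif_pos hex]
  exact (isDevelopingMap_repMap hφ p).isLocalHomeoOn.lineLiftEnd_unique
    ((isGeodesicEndpoint_iff hφ hL).1 hex.choose_spec) ((isGeodesicEndpoint_iff hφ hL).1 h)

lemma isLineLiftEnd_exph (hφ : IsBergmanBasis φ)
    (hL : IsDerivEquiv (repMap φ p (chartAt (CSpace n) p)) q L)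
    {ζ : TangentSpace 𝓘(ℂ, CSpace n) q} (hζ : ζ ∈ exphDomain φ p q) :
    IsLineLiftEnd (regularSet φ p) (repMap φ p (chartAt (CSpace n) p)) q (L ζ)
      (exph φ p q ζ) := by
  obtain ⟨x, hx⟩ := hζ
  rw [exph_eq hφ hL hx]
  exact (isGeodesicEndpoint_iff hφ hL).1 hx

lemma exphImage_eq (hφ : IsBergmanBasis φ)
    (hL : IsDerivEquiv (repMap φ p (chartAt (CSpace n) p)) q L) :
    exphImage φ p q = {x | ∃ v,
      IsLineLiftEnd (regularSet φ p) (repMap φ p (chartAt (CSpace n) p)) q v x} := by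
  ext x
  constructor
  · rintro ⟨ζ, hζ, rfl⟩
    exact ⟨_, isLineLiftEnd_exph hφ hL hζ⟩
  · rintro ⟨v, hv⟩
    have h : IsGeodesicEndpoint φ p q (L.symm v) x :=
      (isGeodesicEndpoint_iff hφ hL).2 (by rwa [L.apply_symm_apply])
    exact ⟨L.symm v, ⟨x, h⟩, exph_eq hφ hL h⟩

/-- The relation `b (exph_q ζ) = b q + L ζ`, solved for `ζ`. -/
lemma apply_exphInv (hφ : IsBergmanBasis φ)
    (hL : IsDerivEquiv (repMap φ p (chartAt (CSpace n) p)) q L) {x : M}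
    (hx : x ∈ exphImage φ p q) :
    L (exphInv φ p q x) =
      repMap φ p (chartAt (CSpace n) p) x - repMap φ p (chartAt (CSpace n) p) q := by
  have h := (isLineLiftEnd_exph hφ hL (Function.invFunOn_mem hx)).map_eq
  rw [Function.invFunOn_eq hx] at h
  rw [h, add_sub_cancel_left]
  rfl

lemma exphImage_subset_regularSet (hφ : IsBergmanBasis φ)
    (hL : IsDerivEquiv (repMap φ p (chartAt (CSpace n) p)) q L) :
    exphImage φ p q ⊆ regularSet φ p := by
  rintro _ ⟨ζ, hζ, rfl⟩
  exact (isLineLiftEnd_exph hφ hL hζ).mem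

lemma injOn_exph (hφ : IsBergmanBasis φ)
    (hL : IsDerivEquiv (repMap φ p (chartAt (CSpace n) p)) q L) :
    InjOn (exph φ p q) (exphDomain φ p q) := by
  intro ζ hζ ζ' hζ' h
  have h1 := (isLineLiftEnd_exph hφ hL hζ).map_eq
  rw [h, (isLineLiftEnd_exph hφ hL hζ').map_eq, add_right_inj] at h1
  exact (L.injective h1).symm

lemma zero_mem_exphDomain_and_exph_zero (hφ : IsBergmanBasis φ) (hq : q ∈ regularSet φ p) :
    0 ∈ exphDomain φ p q ∧ exph φ p q 0 = q := by
  obtain ⟨L, hL⟩ := (isDevelopingMap_repMap hφ p).exists_isDerivEquiv hq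
  have h : IsGeodesicEndpoint φ p q 0 q := (isGeodesicEndpoint_iff hφ hL).2
    ⟨_, _, by rw [map_zero]; exact isLineLift_const hq, rfl⟩
  exact ⟨⟨q, h⟩, exph_eq hφ hL h⟩

/-- The inverse of the exponential map at `q`, before the normalization of the coordinates. -/
lemma vecMul_chartCoord_exphInv (hφ : IsBergmanBasis φ) (hq : q ∈ regularSet φ p)
    (he : e ∈ holCharts (n := n) M) (hqe : q ∈ e.source) (he' : e' ∈ holCharts (n := n) M)
    (hp : p ∈ e'.source) {x : M} (hx : x ∈ exphImage φ p q) :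
    Matrix.vecMul (chartCoord e q (exphInv φ p q x)) (metricMatrix φ e e' (e q) (e' p)) =
      repMap φ p e' x - repMap φ p e' q := by
  obtain ⟨L, hL⟩ := (isDevelopingMap_repMap hφ p).exists_isDerivEquiv hq
  obtain ⟨T, c, hT⟩ := exists_repMap_eq_affine hφ (chartAt_mem_holCharts p) he'
    (mem_chart_source _ p) hp
  rw [vecMul_metricMatrix hφ hq he hqe he' hp hT, ← hL e he hqe, apply_exphInv hφ hL hx,
    hT x (notMem_zeroSet_of_mem_regularSet (exphImage_subset_regularSet hφ hL hx)),
    hT q (notMem_zeroSet_of_mem_regularSet hq), map_sub, add_sub_add_right_eq_sub]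

lemma vecMul_chartCoord_exphInv_of_mul_eq (hφ : IsBergmanBasis φ) (hq : q ∈ regularSet φ p)
    (he : e ∈ holCharts (n := n) M) (hqe : q ∈ e.source) (he' : e' ∈ holCharts (n := n) M)
    (hp : p ∈ e'.source) {A B : Matrix (Fin n) (Fin n) ℂ}
    (hAB : A * B = metricMatrix φ e e' (e q) (e' p)) {x : M} (hx : x ∈ exphImage φ p q) :
    Matrix.vecMul (chartCoord e q (exphInv φ p q x)) A =
      Matrix.vecMul (repMap φ p e' x - repMap φ p e' q) B⁻¹ := by
  have h := isUnit_metricMatrix hφ hq he hqe he' hp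
  rw [← hAB, Matrix.isUnit_iff_isUnit_det, Matrix.det_mul, IsUnit.mul_iff] at h
  rw [← vecMul_chartCoord_exphInv hφ hq he hqe he' hp hx, ← hAB, Matrix.vecMul_vecMul,
    Matrix.mul_assoc, Matrix.mul_nonsing_inv _ h.2, Matrix.mul_one]

lemma exists_exphInv_eq_bergmanRep_sub (hφ : IsBergmanBasis φ) (hM : HasBergmanMetric φ)
    (hq : q ∈ regularSet φ p) (he' : e' ∈ holCharts (n := n) M) (hp : p ∈ e'.source) :
    ∃ L : CSpace n ≃L[ℂ] TangentSpace 𝓘(ℂ, CSpace n) q, ∀ x ∈ exphImage φ p q,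
      exphInv φ p q x = L (bergmanRep φ p e' x - bergmanRep φ p e' q) := by
  have hpr := mem_regularSet_self hM p
  obtain ⟨L, hL⟩ := (isDevelopingMap_repMap hφ p).exists_isDerivEquiv hq
  obtain ⟨T, c, hT⟩ := exists_repMap_eq_affine hφ (chartAt_mem_holCharts p) he'
    (mem_chart_source _ p) hp
  have hdet := (isDevelopingMap_repMap hφ p).det_ne_zero e' he' _ (e'.map_source hp)
    (by rwa [e'.left_inv hp])
  refine ⟨(ContinuousLinearMap.toContinuousLinearEquivOfDetNeZero _ hdet).trans L.symm,
    fun x hx => ?_⟩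
  rw [ContinuousLinearEquiv.trans_apply, ContinuousLinearEquiv.eq_symm_apply]
  refine T.injective ?_
  refine Eq.trans ?_ (congrArg T (coe_toContinuousLinearEquivOfDetNeZero_apply hdet _)).symm
  have hG := (Matrix.isUnit_iff_isUnit_det _).1 (isUnit_metricMatrix hφ hpr he' hp he' hp)
  rw [← vecMul_metricMatrix hφ hpr he' hp he' hp hT, bergmanRep_eq_vecMul he' hp,
    bergmanRep_eq_vecMul he' hp, ← Matrix.sub_vecMul, sub_sub_sub_cancel_right,
    Matrix.vecMul_vecMul, Matrix.nonsing_inv_mul _ hG, Matrix.vecMul_one,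
    apply_exphInv hφ hL hx,
    hT x (notMem_zeroSet_of_mem_regularSet (exphImage_subset_regularSet hφ hL hx)),
    hT q (notMem_zeroSet_of_mem_regularSet hq), map_sub, add_sub_add_right_eq_sub]

lemma chartCoord_exphInv_eq_bergmanRep (hφ : IsBergmanBasis φ) (hM : HasBergmanMetric φ)
    (he' : e' ∈ holCharts (n := n) M) (hp : p ∈ e'.source) {x : M} (hx : x ∈ exphImage φ p p) :
    chartCoord e' p (exphInv φ p p x) = bergmanRep φ p e' x := by
  rw [bergmanRep_eq_vecMul he' hp, ← vecMul_chartCoord_exphInv_of_mul_eq hφ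
    (mem_regularSet_self hM p) he' hp he' hp (Matrix.one_mul _) hx, Matrix.vecMul_one]

lemma exists_exphInv_eq_affine (hφ : IsBergmanBasis φ) {r : M} (hq : q ∈ regularSet φ p)
    (hr : r ∈ regularSet φ p) :
    ∃ (L : TangentSpace 𝓘(ℂ, CSpace n) q ≃L[ℂ] TangentSpace 𝓘(ℂ, CSpace n) r)
      (c : TangentSpace 𝓘(ℂ, CSpace n) r),
      ∀ x ∈ exphImage φ p q ∩ exphImage φ p r, exphInv φ p r x = L (exphInv φ p q x) + c := by
  obtain ⟨L, hL⟩ := (isDevelopingMap_repMap hφ p).exists_isDerivEquiv hq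
  obtain ⟨R, hR⟩ := (isDevelopingMap_repMap hφ p).exists_isDerivEquiv hr
  refine ⟨L.trans R.symm, R.symm (repMap φ p (chartAt (CSpace n) p) q -
    repMap φ p (chartAt (CSpace n) p) r), fun x hx => R.injective ?_⟩
  rw [map_add, ContinuousLinearEquiv.trans_apply, R.apply_symm_apply, R.apply_symm_apply,
    apply_exphInv hφ hL hx.1, apply_exphInv hφ hR hx.2]
  abel

end Exponential

/-! ### The affine structure -/

section AffineStructure

variable {n : ℕ} {M : Type*} [TopologicalSpace M] [ChartedSpace (CSpace n) M]

/-- Every affine atlas is contained in an affine structure. -/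
lemma IsAffineAtlas.exists_isAffineStructure {X : Set M}
    {𝒜₀ : Set (OpenPartialHomeomorph M (CSpace n))} (h : IsAffineAtlas X 𝒜₀) :
    ∃ 𝒜, 𝒜₀ ⊆ 𝒜 ∧ IsAffineStructure X 𝒜 := by
  refine zorn_subset_nonempty {𝒜 | IsAffineAtlas X 𝒜} (fun c hc hchain ⟨𝒜₁, h₁⟩ => ?_) 𝒜₀ h
  refine ⟨⋃₀ c, ?_, fun s hs => subset_sUnion_of_mem hs⟩
  refine ⟨sUnion_subset fun s hs => (hc hs).subset_holCharts, ?_, fun x hx => ?_, ?_⟩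
  · rintro e ⟨s, hs, hes⟩
    exact (hc hs).source_subset e hes
  · obtain ⟨e, he, hxe⟩ := (hc h₁).covers x hx
    exact ⟨e, ⟨𝒜₁, h₁, he⟩, hxe⟩
  · rintro e ⟨s, hs, hes⟩ e' ⟨s', hs', hes'⟩
    rcases hchain.total hs hs' with hss | hss
    · exact (hc hs').affine e (hss hes) e' hes'
    · exact (hc hs).affine e hes e' (hss hes')

/-- The charts that are affine functions of a fixed map `b`. -/
def affineCharts (X : Set M) (b : M → CSpace n) : Set (OpenPartialHomeomorph M (CSpace n)) :=
  {e | e ∈ holCharts (n := n) M ∧ e.source ⊆ X ∧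
    ∃ T : CSpace n ≃ᵃ[ℂ] CSpace n, ∀ x ∈ e.source, e x = T (b x)}

lemma isAffineAtlas_affineCharts {X : Set M} {b : M → CSpace n}
    (h : ∀ x ∈ X, ∃ e ∈ affineCharts X b, x ∈ e.source) : IsAffineAtlas X (affineCharts X b) where
  subset_holCharts _ he := he.1
  source_subset _ he := he.2.1
  covers := h
  affine := by
    rintro e ⟨-, -, T, hT⟩ e' ⟨-, -, T', hT'⟩
    refine ⟨T.symm.trans T', fun z hz => ?_⟩
    simp only [OpenPartialHomeomorph.trans_source, OpenPartialHomeomorph.symm_source,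
      mem_inter_iff, mem_preimage] at hz
    have h1 := hT _ (e.map_target hz.1)
    rw [e.right_inv hz.1] at h1
    have h2 := congrArg T.symm h1
    rw [T.symm_apply_apply] at h2
    simp [hT' _ hz.2, h2]

variable {ι : Type*} {φ : ι → TopForm (n := n) M} [IsManifold 𝓘(ℂ, CSpace n) ω M]
  [SecondCountableTopology M] [Nonempty M] {e : OpenPartialHomeomorph M (CSpace n)} {p q : M}

/-- The inverse of the exponential map at `q` is a holomorphic chart. -/
lemma exists_exph_chart [T2Space M] (hφ : IsBergmanBasis φ) (hq : q ∈ regularSet φ p) :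
    ∃ e ∈ affineCharts (regularSet φ p) (repMap φ p (chartAt (CSpace n) p)),
      ∃ L : TangentSpace 𝓘(ℂ, CSpace n) q ≃L[ℂ] CSpace n,
        e.source = exphImage φ p q ∧ e.target = L '' exphDomain φ p q ∧
        (∀ x ∈ exphImage φ p q, e x = L (exphInv φ p q x)) ∧
        (∀ ζ ∈ exphDomain φ p q, e.symm (L ζ) = exph φ p q ζ) := by
  have hb := isDevelopingMap_repMap hφ p
  obtain ⟨L, hL⟩ := hb.exists_isDerivEquiv hq
  set b := repMap φ p (chartAt (CSpace n) p)
  have hmap : ∀ ζ ∈ exphDomain φ p q, b (exph φ p q ζ) = b q + L ζ := fun ζ hζ =>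
    (isLineLiftEnd_exph hφ hL hζ).map_eq
  have hopen : IsOpen (exphImage φ p q) := by
    rw [exphImage_eq hφ hL]; exact hb.isLocalHomeoOn.isOpen_setOf_lineLiftEnd q
  have hinj : InjOn b (exphImage φ p q) := by
    rintro _ ⟨ζ, hζ, rfl⟩ _ ⟨ζ', hζ', rfl⟩ h
    rw [hmap ζ hζ, hmap ζ' hζ', add_right_inj] at h
    rw [L.injective h]
  obtain ⟨ψ₀, hs, hψ₀⟩ := hb.isLocalHomeoOn.exists_openPartialHomeomorph hopen
    (exphImage_subset_regularSet hφ hL) hinj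
  set ψ := ψ₀.transHomeomorph (Homeomorph.subRight (b q))
  have hψs : ψ.source = exphImage φ p q := hs
  have hψ : ∀ x, ψ x = b x - b q := fun x => by
    change ψ₀ x - b q = b x - b q
    rw [hψ₀]
  have hψζ : ∀ ζ ∈ exphDomain φ p q, ψ (exph φ p q ζ) = L ζ := fun ζ hζ => by
    rw [hψ, hmap ζ hζ, add_sub_cancel_left]
  have hsub : ψ.source ⊆ regularSet φ p := hψs ▸ exphImage_subset_regularSet hφ hL
  refine ⟨ψ, ⟨hb.mem_holCharts hsub fun x _ => hψ x, hsub,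
    AffineEquiv.constVAdd ℂ (CSpace n) (-b q), fun x _ => ?_⟩, L, hψs, ?_, ?_, ?_⟩
  · rw [hψ, AffineEquiv.constVAdd_apply, vadd_eq_add]; abel
  · rw [← ψ.image_source_eq_target, hψs, exphImage, image_image]
    exact image_congr hψζ
  · intro x hx
    rw [hψ, apply_exphInv hφ hL hx]
  · intro ζ hζ
    rw [← hψζ ζ hζ]
    exact ψ.left_inv (hψs ▸ ⟨ζ, hζ, rfl⟩)

/-- The Christoffel symbols vanish in coordinates in which the developing map is affine. -/
lemma christoffel_eq_zero (hφ : IsBergmanBasis φ) (he : e ∈ holCharts (n := n) M) {z : CSpace n}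
    (hz : z ∈ e.target) (hzX : e.symm z ∈ regularSet φ p) {T : CSpace n ≃ᵃ[ℂ] CSpace n}
    {c : CSpace n}
    (h : ∀ᶠ w in 𝓝 z, repMap φ p (chartAt (CSpace n) p) (e.symm w) = T w + c) (j k l : Fin n) :
    christoffel φ p e z j k l = 0 := by
  have hT : ∀ w, HasFDerivAt (fun w => T w + c)
      (LinearMap.toContinuousLinearMap (T.linear : CSpace n →ₗ[ℂ] CSpace n)) w := fun w => by
    have h1 := ((LinearMap.toContinuousLinearMap
      (T.linear : CSpace n →ₗ[ℂ] CSpace n)).hasFDerivAt (x := w)).add_const (T 0 + c)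
    refine h1.congr_of_eventuallyEq (Eventually.of_forall fun w' => ?_)
    have h2 := congrFun (AffineMap.decomp (T : CSpace n →ᵃ[ℂ] CSpace n)) w'
    simp only [Pi.add_apply] at h2
    change T w' = T.linear w' + T 0 at h2
    simp [h2, add_assoc]
  have h1 : fderiv ℂ (repMap φ p (chartAt (CSpace n) p) ∘ e.symm) =ᶠ[𝓝 z]
      fun _ => LinearMap.toContinuousLinearMap (T.linear : CSpace n →ₗ[ℂ] CSpace n) := by
    filter_upwards [h.eventually_nhds] with w hw
    rw [← (hT w).fderiv]
    exact EventuallyEq.fderiv_eq hw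
  have h2 : fderiv ℂ (fderiv ℂ (repMap φ p (chartAt (CSpace n) p) ∘ e.symm)) z = 0 := by
    rw [h1.fderiv_eq, fderiv_fun_const]
    rfl
  simp [christoffel, dz_metricMatrix hφ he hz hzX, h2]

lemma christoffel_eq_zero_of_isAffineAtlas (hφ : IsBergmanBasis φ)
    {𝒜 : Set (OpenPartialHomeomorph M (CSpace n))} (h𝒜 : IsAffineAtlas (regularSet φ p) 𝒜)
    {e' : OpenPartialHomeomorph M (CSpace n)} (he' : e' ∈ 𝒜) {S : CSpace n ≃ᵃ[ℂ] CSpace n}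
    (hS : ∀ x ∈ e'.source, e' x = S (repMap φ p (chartAt (CSpace n) p) x))
    (he : e ∈ 𝒜) {z : CSpace n} (hz : z ∈ e.target) (hz' : e.symm z ∈ e'.source)
    (j k l : Fin n) : christoffel φ p e z j k l = 0 := by
  obtain ⟨T, hT⟩ := h𝒜.affine e he e' he'
  refine christoffel_eq_zero hφ (h𝒜.subset_holCharts he) hz
    (h𝒜.source_subset e he (e.map_target hz)) (T := T.trans S.symm) (c := 0) ?_ j k l
  filter_upwards [(isOpen_transition_source e' e).mem_nhds ⟨hz, hz'⟩] with w hw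
  have h1 := hT (x := w) (by simpa using hw)
  simp only [OpenPartialHomeomorph.coe_trans, Function.comp_apply, hS _ hw.2] at h1
  simp [← h1]

end AffineStructure

end BergmanGeometry

theorem mainTheorem4 {n : ℕ} {M : Type*} [TopologicalSpace M] [T2Space M]
    [SecondCountableTopology M] [Nonempty M] [ChartedSpace (CSpace n) M]
    [IsManifold 𝓘(ℂ, CSpace n) ω M]
    {ι : Type*} (φ : ι → TopForm (n := n) M) (hφ : IsBergmanBasis φ)
    (hM : HasBergmanMetric φ) (p : M) :
    -- the set `M^p` is an open neighbourhood of `p`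
    IsOpen (regularSet φ p) ∧ p ∈ regularSet φ p ∧
    -- for `q` in `M^p`, `exph_q` is well defined and injective on an open set that contains `0`
    (∀ q ∈ regularSet φ p,
      (∀ ζ x, IsGeodesicEndpoint φ p q ζ x → exph φ p q ζ = x) ∧
      IsOpen (exphDomain φ p q) ∧ 0 ∈ exphDomain φ p q ∧ exph φ p q 0 = q ∧
      Set.InjOn (exph φ p q) (exphDomain φ p q) ∧
      IsOpen (exphImage φ p q) ∧ exphImage φ p q ⊆ regularSet φ p ∧
      -- the formula for the inverse, in the linear coordinates `dz(·) A` of the tangent space at `q`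
      (∀ e ∈ holCharts (n := n) M, q ∈ e.source → ∀ e' ∈ holCharts (n := n) M, p ∈ e'.source →
        ∀ A B : Matrix (Fin n) (Fin n) ℂ, A * B = metricMatrix φ e e' (e q) (e' p) →
        ∀ x ∈ exphImage φ p q ∩ e.source, ∀ j,
          Matrix.vecMul (chartCoord e q (exphInv φ p q x)) A j =
            ∑ k, B⁻¹ k j *
              (dbarLogKernel φ e e' k (e x) (e' p) - dbarLogKernel φ e e' k (e q) (e' p))) ∧
      -- the inverse is a linear transform of the representative coordinates centred at `q`
      (∀ e' ∈ holCharts (n := n) M, p ∈ e'.source →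
        ∃ L : CSpace n ≃L[ℂ] TangentSpace 𝓘(ℂ, CSpace n) q, ∀ x ∈ exphImage φ p q,
          exphInv φ p q x = L (bergmanRep φ p e' x - bergmanRep φ p e' q))) ∧
    -- the inverse of `exph_p` is the representative map, in the coordinates `dw(·)`
    (∀ e' ∈ holCharts (n := n) M, p ∈ e'.source → ∀ x ∈ exphImage φ p p,
      chartCoord e' p (exphInv φ p p x) = bergmanRep φ p e' x) ∧
    -- any two of these inverses differ by an affine transformation
    (∀ q ∈ regularSet φ p, ∀ r ∈ regularSet φ p,
      ∃ (L : TangentSpace 𝓘(ℂ, CSpace n) q ≃L[ℂ] TangentSpace 𝓘(ℂ, CSpace n) r)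
        (c : TangentSpace 𝓘(ℂ, CSpace n) r),
        ∀ x ∈ exphImage φ p q ∩ exphImage φ p r, exphInv φ p r x = L (exphInv φ p q x) + c) ∧
    -- the inverses are the charts of a complex affine structure on `M^p`, the one that corresponds
    -- to the Bochner connection
    (∃ 𝒜 : Set (OpenPartialHomeomorph M (CSpace n)), IsAffineStructure (regularSet φ p) 𝒜 ∧
      (∀ q ∈ regularSet φ p, ∃ e ∈ 𝒜, ∃ L : TangentSpace 𝓘(ℂ, CSpace n) q ≃L[ℂ] CSpace n,
        e.source = exphImage φ p q ∧ e.target = L '' exphDomain φ p q ∧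
        (∀ x ∈ exphImage φ p q, e x = L (exphInv φ p q x)) ∧
        (∀ ζ ∈ exphDomain φ p q, e.symm (L ζ) = exph φ p q ζ)) ∧
      (∀ e ∈ 𝒜, ∀ z ∈ e.target, ∀ j k l, christoffel φ p e z j k l = 0)) := by
  have hb := isDevelopingMap_repMap hφ p
  have hp := mem_regularSet_self hM p
  refine ⟨hb.isOpen, hp, fun q hq => ?_, fun e' he' hpe' x hx =>
    chartCoord_exphInv_eq_bergmanRep hφ hM he' hpe' hx, fun q hq r hr =>
    exists_exphInv_eq_affine hφ hq hr, ?_⟩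
  · obtain ⟨L, hL⟩ := hb.exists_isDerivEquiv hq
    have h0 := zero_mem_exphDomain_and_exph_zero hφ hq
    refine ⟨fun ζ x => exph_eq hφ hL, ?_, h0.1, h0.2, injOn_exph hφ hL, ?_,
      exphImage_subset_regularSet hφ hL, ?_, fun e' he' hpe' =>
      exists_exphInv_eq_bergmanRep_sub hφ hM hq he' hpe'⟩
    · rw [exphDomain_eq hφ hL]
      exact (hb.isLocalHomeoOn.isOpen_setOf_exists_lineLiftEnd q).preimage L.continuous
    · rw [exphImage_eq hφ hL]
      exact hb.isLocalHomeoOn.isOpen_setOf_lineLiftEnd q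
    · intro e he hqe e' he' hpe' A B hAB x hx j
      rw [vecMul_chartCoord_exphInv_of_mul_eq hφ hq he hqe he' hpe' hAB hx.1]
      simp only [Matrix.vecMul, dotProduct, dbarLogKernel_eq_repMap he p (e.map_source hx.2),
        dbarLogKernel_eq_repMap he p (e.map_source hqe), e.left_inv hx.2, e.left_inv hqe]
      exact Finset.sum_congr rfl fun k _ => mul_comm _ _
  · have hcover : ∀ x ∈ regularSet φ p, ∃ e ∈ affineCharts (regularSet φ p)
        (repMap φ p (chartAt (CSpace n) p)), x ∈ e.source := fun x hx => by
      obtain ⟨e, he, L, hs, -⟩ := exists_exph_chart hφ hx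
      have h0 := zero_mem_exphDomain_and_exph_zero hφ hx
      exact ⟨e, he, hs ▸ ⟨0, h0⟩⟩
    obtain ⟨𝒜, h𝒜₀, h𝒜⟩ := (isAffineAtlas_affineCharts hcover).exists_isAffineStructure
    refine ⟨𝒜, h𝒜, fun q hq => ?_, fun e he z hz j k l => ?_⟩
    · obtain ⟨e, he, h⟩ := exists_exph_chart hφ hq
      exact ⟨e, h𝒜₀ he, h⟩
    · obtain ⟨e', he', hze'⟩ := hcover _ (h𝒜.prop.source_subset e he (e.map_target hz))
      obtain ⟨-, -, S, hS⟩ := id he'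
      exact christoffel_eq_zero_of_isAffineAtlas hφ h𝒜.prop (h𝒜₀ he') hS he hz hze' j k l
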